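/- \textbf{Conventions.} A complete graph on four vertices is a 3-tree, and so is every graph obtained from a 3-tree by adding a new vertex adjacent to exactly the vertices of a 3-clique. A \emph{planar straight-line drawing} of a finite simple graph places its vertices at distinct points of the plane and draws every edge as a straight segment, so that no vertex lies on an edge of which it is not an end and two distinct edges meet at most at a common end. A \emph{plane graph} is a planar graph together with a plane embedding (a cyclic order of the edges around each vertex, and an outer face); a planar straight-line drawing of a plane graph always means one that respects this embedding. A \emph{plane 3-tree} is a plane graph that is a 3-tree; a plane cycle with three vertices is also regarded as a plane 3-tree. A set $R$ of vertices of a plane graph $G$ is a \emph{collinear set} if $G$ has a planar straight-line drawing in which all vertices of $R$ are collinear. It is a \emph{free collinear set} if there is a total order $<_R$ on $R$ such that, for every directed line $\ell$ and every set of $|R|$ points on $\ell$, $G$ has a planar straight-line drawing in which the vertices of $R$ are placed at the given points and their order along $\ell$ is $<_R$. \textbf{Theorem.} Let $G$ be a plane 3-tree. (1) Every collinear set of $G$ is a free collinear set of $G$. (2) Let $\Psi$ be a planar straight-line drawing of $G$ and let $\ell$ be a directed line. Let $S$ be the set of vertices that lie on $\ell$ in $\Psi$, and let $E_\ell$ be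 the set of edges that properly cross $\ell$ in $\Psi$, i.e. whose ends lie strictly on different sides of $\ell$. Let $<_\Psi$ be the order in which the elements of $S\cup E_\ell$ meet $\ell$ in $\Psi$. Let $A\subseteq S\cup E_\ell$ (for instance $A=S\cup E_\ell$, or a set $A\subseteq S$ of vertices), and let $(q_x)_{x\in A}$ be points on $\ell$ such that $q_x$ precedes $q_y$ along $\ell$ whenever $x<_\Psi y$. Then $G$ has a planar straight-line drawing $\Gamma$ such that every vertex of $G$ lies on the left of $\ell$, on the right of $\ell$, or on $\ell$ in $\Gamma$ according to whether it does so in $\Psi$; every vertex $x\in A$ is placed at $q_x$; and every edge $x\in A$ crosses $\ell$ at $q_x$. -/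

import Mathlib

/-- The Euclidean plane. -/
abbrev Plane : Type := EuclideanSpace ℝ (Fin 2)

/-- The cross product (signed area) of two vectors of the plane; it is positive if and only if
`y` points strictly to the left of `x`. -/
def cross (x y : Plane) : ℝ := x 0 * y 1 - x 1 * y 0

/-- Counterclockwise rotation by a right angle. -/
def rotateLeft (x : Plane) : Plane := !₂[-(x 1), x 0]

/-- `p : V → Plane` (edges being drawn as straight segments) is a planar straight-line drawing
of `G`: vertices are distinct points, no vertex lies on an edge that it is not an end of, and
two distinct edges meet at most at a common end. -/
structure IsPlanarDrawing {V : Type*} (G : SimpleGraph V) (p : V → Plane) : Prop where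
  injective : Function.Injective p
  vertex_notMem : ∀ u v w : V, G.Adj u v → w ≠ u → w ≠ v → p w ∉ segment ℝ (p u) (p v)
  edge_inter : ∀ u v x y : V, G.Adj u v → G.Adj x y → s(u, v) ≠ s(x, y) →
    segment ℝ (p u) (p v) ∩ segment ℝ (p x) (p y) ⊆ p '' (({u, v} : Set V) ∩ {x, y})

/-- The set of points covered by a drawing. -/
def drawnSet {V : Type*} (G : SimpleGraph V) (p : V → Plane) : Set Plane :=
  Set.range p ∪ {x | ∃ u v : V, G.Adj u v ∧ x ∈ segment ℝ (p u) (p v)}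

/-- The outer face: the points off the drawing whose component of the complement is unbounded. -/
def outerFace {V : Type*} (G : SimpleGraph V) (p : V → Plane) : Set Plane :=
  {x | x ∉ drawnSet G p ∧ ¬ Bornology.IsBounded (connectedComponentIn (drawnSet G p)ᶜ x)}

/-- The directed edge `u → v` is on the walk that delimits the outer face, that is, the outer
face lies immediately to the left of the edge when it is traversed from `u` to `v`. The set of
these directed edges is the facial walk of the outer face, traversed with the face on the left. -/
def IsOuterDart {V : Type*} (G : SimpleGraph V) (p : V → Plane) (u v : V) : Prop :=
  G.Adj u v ∧ ∀ᶠ ε in nhdsWithin (0 : ℝ) (Set.Ioi 0),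
    midpoint ℝ (p u) (p v) + ε • rotateLeft (p v - p u) ∈ outerFace G p

/-- Three vectors with pairwise distinct directions point in this counterclockwise cyclic order.
The counterclockwise angles from `x` to `y`, `y` to `z` and `z` to `x` lie strictly between `0`
and `2π` and add up to `2π` (counterclockwise order) or to `4π` (clockwise order); so at least
two of them are smaller than `π` in the first case, and at most one in the second. An angle is
smaller than `π` if and only if the cross product is positive. -/
def IsCCW (x y z : Plane) : Prop :=
  (0 < cross x y ∧ 0 < cross y z) ∨ (0 < cross y z ∧ 0 < cross z x) ∨
    (0 < cross z x ∧ 0 < cross x y)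

/-- Two planar straight-line drawings of `G` are equivalent: they have the same rotation system
(the same cyclic order of the edges around each vertex) and the same outer face. -/
structure SameEmbedding {V : Type*} (G : SimpleGraph V) (p q : V → Plane) : Prop where
  rotation : ∀ v a b c : V, G.Adj v a → G.Adj v b → G.Adj v c →
    (IsCCW (p a - p v) (p b - p v) (p c - p v) ↔ IsCCW (q a - q v) (q b - q v) (q c - q v))
  outer : ∀ u v : V, IsOuterDart G p u v ↔ IsOuterDart G q u v

/-- A plane graph: a graph with a plane embedding, the latter being the equivalence class of the
planar straight-line drawing `repr`. -/
structure PlaneGraph (V : Type*) where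
  graph : SimpleGraph V
  repr : V → Plane
  isPlanarDrawing_repr : IsPlanarDrawing graph repr

/-- The planar straight-line drawings of a plane graph are those that respect its embedding. -/
def PlaneGraph.IsDrawing {V : Type*} (G : PlaneGraph V) (p : V → Plane) : Prop :=
  IsPlanarDrawing G.graph p ∧ SameEmbedding G.graph G.repr p

/-- `IsKTreeOn G k s`: the subgraph of `G` induced by `s` is a `k`-tree. A complete graph on
`k + 1` vertices is a `k`-tree, and so is the graph obtained from a `k`-tree by adding a new
vertex and making it adjacent to exactly the vertices of a `k`-clique. -/
inductive IsKTreeOn {V : Type*} (G : SimpleGraph V) (k : ℕ) : Finset V → Prop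
  | base (s : Finset V) (hs : G.IsNClique (k + 1) s) : IsKTreeOn G k s
  | step (s K : Finset V) (v : V) (hv : v ∉ s) (h : IsKTreeOn G k s) (hK : K ⊆ s)
      (hclique : G.IsNClique k K) (hadj : ∀ u ∈ s, G.Adj v u ↔ u ∈ K) :
      IsKTreeOn G k (Finset.cons v s hv)

/-- A plane 3-tree: a plane graph that is a 3-tree; a triangle is also regarded as one. -/
def PlaneGraph.IsPlane3Tree {V : Type*} [Fintype V] (G : PlaneGraph V) : Prop :=
  IsKTreeOn G.graph 3 Finset.univ ∨ G.graph.IsNClique 3 Finset.univ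

/-- Some planar straight-line drawing puts all vertices of `R` on a line. -/
def PlaneGraph.IsCollinearSet {V : Type*} (G : PlaneGraph V) (R : Set V) : Prop :=
  ∃ p : V → Plane, G.IsDrawing p ∧ Collinear ℝ (p '' R)

/-- There is a total order on `R` such that, for every line `{a + s • d | s ∈ ℝ}` and every choice
of `|R|` distinct points on it, some planar straight-line drawing puts the vertices of `R` at
these points, in this order along the line. -/
def PlaneGraph.IsFreeCollinearSet {V : Type*} (G : PlaneGraph V) (R : Set V) : Prop :=
  ∃ _ : LinearOrder R, ∀ a d : Plane, d ≠ 0 → ∀ t : R → ℝ, StrictMono t →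
    ∃ p : V → Plane, G.IsDrawing p ∧ ∀ r : R, p r = a + t r • d

/-- The side of the line `{a + s • d | s ∈ ℝ}` on which `x` lies: positive to the left of the
line directed by `d`, negative to the right, zero on the line. -/
def side (a d x : Plane) : ℝ := cross d (x - a)

/-- The point set drawn for a vertex (a point) or for an edge (a segment). -/
def cell {V : Type*} (p : V → Plane) : V ⊕ Sym2 V → Set Plane
  | Sum.inl v => {p v}
  | Sum.inr e => convexHull ℝ (p '' {v | v ∈ e})

/-- The vertices that lie on the line `{a + s • d | s ∈ ℝ}`, together with the edges that cross it
properly, that is, whose ends lie strictly on different sides of it. -/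
def lineElements {V : Type*} (G : SimpleGraph V) (p : V → Plane) (a d : Plane) :
    Set (V ⊕ Sym2 V) :=
  {x | (∃ v : V, x = Sum.inl v ∧ side a d (p v) = 0) ∨
    ∃ u v : V, x = Sum.inr s(u, v) ∧ G.Adj u v ∧ 0 < side a d (p u) ∧ side a d (p v) < 0}

/-- `x` meets the line `{a + s • d | s ∈ ℝ}` before `y` does, in the direction of `d`. -/
def Precedes {V : Type*} (p : V → Plane) (a d : Plane) (x y : V ⊕ Sym2 V) : Prop :=
  ∃ s t : ℝ, s < t ∧ a + s • d ∈ cell p x ∧ a + t • d ∈ cell p y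

/-! A plane 3-tree is a triangle into whose faces vertices are inserted one after another
(`Stacked`). The proof rests on two facts. First, positivity suffices: if every final inner face is
drawn with positive orientation (`Positive`), then each vertex lies inside the face into which it
was inserted. The drawing is therefore planar (`Stacked.invariant`), and its rotation system and
outer face depend on the combinatorics alone (`Stacked.sameEmbedding`). Conversely, every planar
drawing of a plane 3-tree arises in this way (`PlaneGraph.IsPlane3Tree.exists_stacked`).

Second, crossings can be moved freely. Take coordinates in which the line is the horizontal axis,
and let `f : ℝ → ℝ` be strictly increasing. `Stacked.exists_realization` builds a positive drawing
in which every vertex keeps its side and every vertex or crossing at abscissa `s` moves to `f s`.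
The root triangle meets the axis transversally in at most two points, where `f` agrees with an
increasing affine map, so a horizontal stretch serves. For a vertex `v` inserted into a face
(`hasInsert`), the orientation of a triangle with one corner across the axis is encoded by the order
of two crossings (`orient_pos_iff_crossing`), and `f` preserves this order. If `v` lies on the axis,
its place is prescribed. Otherwise at most two edges from `v` to the corners cross the axis: with
two, `v` is the intersection of two prescribed lines; with one, it lies on a prescribed ray just
beyond the axis; with none, the centroid will do.

Both parts of the theorem follow: the finitely many prescribed positions are interpolated by one
strictly increasing `f` (`exists_strictMono_extension`), and a similarity carries the axis to the
given line. -/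

/-! ### Signed areas, segments and triangles -/

/-- Twice the signed area of the triangle `x y z`. -/
def orient (x y z : Plane) : ℝ := cross (y - x) (z - x)

lemma orient_eq (x y z : Plane) :
    orient x y z = (y 0 - x 0) * (z 1 - x 1) - (y 1 - x 1) * (z 0 - x 0) := by
  simp [orient, cross]

lemma orient_rotate (x y z : Plane) : orient y z x = orient x y z := by
  simp only [orient_eq]; ring

lemma orient_swap (x y z : Plane) : orient y x z = -orient x y z := by
  simp only [orient_eq]; ring

lemma orient_swap_right (x y z : Plane) : orient x z y = -orient x y z := by
  simp only [orient_eq]; ring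

/-- The point `v` lies in the open triangle `a b c`, which is positively oriented. -/
def Inside (a b c v : Plane) : Prop :=
  0 < orient v b c ∧ 0 < orient a v c ∧ 0 < orient a b v

lemma Inside.rotate {a b c v : Plane} (h : Inside a b c v) : Inside b c a v := by
  obtain ⟨h1, h2, h3⟩ := h
  simp only [Inside, orient_eq] at *
  refine ⟨?_, ?_, ?_⟩ <;> linarith

lemma inside_rotate {a b c v : Plane} : Inside b c a v ↔ Inside a b c v :=
  ⟨fun h => h.rotate.rotate, fun h => h.rotate⟩

lemma orient_add (a b c v : Plane) :
    orient v b c + orient a v c + orient a b v = orient a b c := by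
  simp only [orient_eq]; ring

/-- Barycentric coordinates with denominators cleared; `orient_add` gives the sum of the weights.
Applied with `i = 1`, this relates the height of `v` to those of the corners. -/
lemma orient_bary (a b c v : Plane) (i : Fin 2) :
    orient v b c * a i + orient a v c * b i + orient a b v * c i = orient a b c * v i := by
  fin_cases i <;> simp only [orient_eq, Fin.zero_eta, Fin.mk_one] <;> ring

lemma Inside.pos {a b c v : Plane} (h : Inside a b c v) : 0 < orient a b c := by
  have := orient_add a b c v
  obtain ⟨h1, h2, h3⟩ := h
  linarith

lemma plane_ext {x y : Plane} (h0 : x 0 = y 0) (h1 : x 1 = y 1) : x = y := by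
  ext i; fin_cases i
  · exact h0
  · exact h1

lemma mem_segment_iff_coord {x y z : Plane} :
    z ∈ segment ℝ x y ↔ ∃ t : ℝ, 0 ≤ t ∧ t ≤ 1 ∧ ∀ i, z i = (1 - t) * x i + t * y i := by
  rw [segment_eq_image]
  constructor
  · rintro ⟨t, ⟨h0, h1⟩, rfl⟩
    exact ⟨t, h0, h1, fun i => by simp⟩
  · rintro ⟨t, h0, h1, h⟩
    refine ⟨t, ⟨h0, h1⟩, ?_⟩
    ext i
    simp [h i]

lemma orient_lineMap_right (a b x y z : Plane) (t : ℝ)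
    (h : ∀ i, z i = (1 - t) * x i + t * y i) :
    orient a b z = (1 - t) * orient a b x + t * orient a b y := by
  simp only [orient_eq, h]; ring

lemma orient_lineMap_left (a b x y z : Plane) (t : ℝ)
    (h : ∀ i, z i = (1 - t) * x i + t * y i) :
    orient z a b = (1 - t) * orient x a b + t * orient y a b := by
  simp only [orient_eq, h]; ring

lemma orient_lineMap_middle (a b x y z : Plane) (t : ℝ)
    (h : ∀ i, z i = (1 - t) * x i + t * y i) :
    orient a z b = (1 - t) * orient a x b + t * orient a y b := by
  simp only [orient_eq, h]; ring

lemma orient_self_left (a b : Plane) : orient a a b = 0 := by simp only [orient_eq]; ring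
lemma orient_self_right (a b : Plane) : orient a b b = 0 := by simp only [orient_eq]; ring
lemma orient_self_outer (a b : Plane) : orient a b a = 0 := by simp only [orient_eq]; ring

lemma orient_eq_zero_of_mem_segment {a b x : Plane} (h : x ∈ segment ℝ a b) :
    orient a b x = 0 := by
  obtain ⟨t, -, -, h⟩ := mem_segment_iff_coord.1 h
  rw [orient_lineMap_right _ _ _ _ _ t h, orient_self_outer, orient_self_right]; ring

lemma mem_segment_of_orient {a b c v : Plane} (h : orient a b v = 0) (h1 : 0 ≤ orient v b c)
    (h2 : 0 ≤ orient a v c) (hD : 0 < orient a b c) : v ∈ segment ℝ a b := by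
  have hs := orient_add a b c v
  refine mem_segment_iff_coord.2 ⟨orient a v c / orient a b c, by positivity, ?_, fun i => ?_⟩
  · rw [div_le_one hD]; linarith
  · have := orient_bary a b c v i
    rw [h] at this hs
    field_simp
    linear_combination -this + a i * hs

/-- A segment from a point of an open triangle to a vertex stays in the open triangle. -/
lemma inside_or_eq_of_mem_segment {a b c v x : Plane} (hv : Inside a b c v)
    (hx : x ∈ segment ℝ v a) : Inside a b c x ∨ x = a := by
  obtain ⟨t, h0, h1, h⟩ := mem_segment_iff_coord.1 hx
  have hD := hv.pos
  obtain ⟨k1, k2, k3⟩ := hv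
  rcases h1.eq_or_lt with rfl | h1
  · right
    exact plane_ext (by simp [h 0]) (by simp [h 1])
  · left
    have h1' : 0 < 1 - t := by linarith
    refine ⟨?_, ?_, ?_⟩
    · rw [orient_lineMap_left _ _ _ _ _ t h]; positivity
    · rw [orient_lineMap_middle _ _ _ _ _ t h, orient_self_left]; simp; positivity
    · rw [orient_lineMap_right _ _ _ _ _ t h, orient_self_outer]; simp; positivity

lemma mem_segment_boundary {a b c z : Plane} (hD : 0 < orient a b c) (h1 : 0 ≤ orient z b c)
    (h2 : 0 ≤ orient a z c) (h3 : 0 ≤ orient a b z)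
    (h : orient z b c = 0 ∨ orient a z c = 0 ∨ orient a b z = 0) :
    z ∈ segment ℝ a b ∨ z ∈ segment ℝ b c ∨ z ∈ segment ℝ c a := by
  rcases h with h | h | h
  · refine Or.inr (Or.inl (mem_segment_of_orient (c := a) ?_ ?_ ?_ ?_))
    · rwa [orient_rotate z b c]
    · rwa [orient_rotate a z c]
    · rwa [orient_rotate a b z]
    · rwa [orient_rotate a b c]
  · refine Or.inr (Or.inr (mem_segment_of_orient (c := b) ?_ ?_ ?_ ?_))
    · rwa [orient_rotate z c a, orient_rotate a z c]
    · rwa [orient_rotate b z a, orient_rotate a b z]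
    · rwa [orient_rotate b c z, orient_rotate z b c]
    · rwa [orient_rotate b c a, orient_rotate a b c]
  · exact Or.inl (mem_segment_of_orient h h1 h2 hD)

/-- A segment that leaves an open triangle meets its boundary. -/
lemma exists_mem_segment_boundary {a b c x y : Plane} (hx : Inside a b c x)
    (hy : ¬ Inside a b c y) :
    ∃ z ∈ segment ℝ x y, z ∈ segment ℝ a b ∨ z ∈ segment ℝ b c ∨ z ∈ segment ℝ c a := by
  have hD := hx.pos
  set A : ℝ → ℝ := fun t => (1 - t) * orient x b c + t * orient y b c with hA
  set B : ℝ → ℝ := fun t => (1 - t) * orient a x c + t * orient a y c with hB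
  set C : ℝ → ℝ := fun t => (1 - t) * orient a b x + t * orient a b y with hC
  -- The least of the three barycentric weights goes from nonnegative to nonpositive along the
  -- segment. Where it vanishes, all weights are nonnegative and one is zero.
  have hcont : Continuous fun t => min (A t) (min (B t) (C t)) := by fun_prop
  have h0 : 0 ≤ min (A 0) (min (B 0) (C 0)) := by
    obtain ⟨h1, h2, h3⟩ := hx
    simp [hA, hB, hC, h1.le, h2.le, h3.le]
  have h1 : min (A 1) (min (B 1) (C 1)) ≤ 0 := by
    by_contra hc
    rw [not_le, lt_min_iff, lt_min_iff] at hc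
    apply hy
    simpa [hA, hB, hC, Inside] using hc
  obtain ⟨t, ⟨ht0, ht1⟩, ht⟩ := intermediate_value_Icc' zero_le_one hcont.continuousOn ⟨h1, h0⟩
  set z : Plane := !₂[(1 - t) * x 0 + t * y 0, (1 - t) * x 1 + t * y 1] with hz
  have hzi : ∀ i, z i = (1 - t) * x i + t * y i := by
    intro i; fin_cases i <;> simp [hz]
  have e1 : orient z b c = A t := orient_lineMap_left _ _ _ _ _ t hzi
  have e2 : orient a z c = B t := orient_lineMap_middle _ _ _ _ _ t hzi
  have e3 : orient a b z = C t := orient_lineMap_right _ _ _ _ _ t hzi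
  refine ⟨z, mem_segment_iff_coord.2 ⟨t, ht0, ht1, hzi⟩, ?_⟩
  have hA0 : 0 ≤ A t := ht.symm.le.trans (min_le_left _ _)
  have hB0 : 0 ≤ B t := ht.symm.le.trans ((min_le_right _ _).trans (min_le_left _ _))
  have hC0 : 0 ≤ C t := ht.symm.le.trans ((min_le_right _ _).trans (min_le_right _ _))
  refine mem_segment_boundary hD (e1 ▸ hA0) (e2 ▸ hB0) (e3 ▸ hC0) ?_
  rw [e1, e2, e3]
  rcases min_choice (A t) (min (B t) (C t)) with h | h
  · exact Or.inl (h ▸ ht)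
  · rcases min_choice (B t) (C t) with h' | h'
    · exact Or.inr (Or.inl (h' ▸ h ▸ ht))
    · exact Or.inr (Or.inr (h' ▸ h ▸ ht))

lemma affineIndependent_of_orient {a b c : Plane} (h : orient a b c ≠ 0) :
    AffineIndependent ℝ ![a, b, c] := by
  rw [affineIndependent_iff_not_collinear_set, collinear_iff_exists_forall_eq_smul_vadd]
  rintro ⟨o, d, hd⟩
  obtain ⟨r, rfl⟩ := hd a (by simp)
  obtain ⟨s, rfl⟩ := hd b (by simp)
  obtain ⟨t, rfl⟩ := hd c (by simp)
  apply h
  simp [orient_eq]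
  ring

/-- Two faces of a nondegenerate simplex meet in their common face. -/
lemma convexHull_image_inter {V : Type*} {p : V → Plane} {a b c : V}
    (h : orient (p a) (p b) (p c) ≠ 0) {e e' : Set V} (he : e ⊆ {a, b, c})
    (he' : e' ⊆ {a, b, c}) :
    convexHull ℝ (p '' e) ∩ convexHull ℝ (p '' e') ⊆ convexHull ℝ (p '' (e ∩ e')) := by
  classical
  have hI := affineIndependent_of_orient h
  have hinj : Set.InjOn p {a, b, c} := by
    have hab : p a ≠ p b := fun k => h (by rw [k, orient_self_left])
    have hbc : p b ≠ p c := fun k => h (by rw [k, orient_self_right])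
    have hac : p a ≠ p c := fun k => h (by rw [k, orient_self_outer])
    rintro x (rfl | rfl | rfl) y (rfl | rfl | rfl) k <;>
      first | rfl | exact absurd k (by assumption) | exact absurd k.symm (by assumption)
  have hr := hI.range
  have hfin : ∀ e : Set V, e ⊆ {a, b, c} → (p '' e).Finite := fun e he =>
    ((Set.toFinite {a, b, c}).subset he).image p
  have hset : Set.range ![p a, p b, p c] = ((({p a, p b, p c} : Finset Plane)) : Set Plane) := by
    simp [Matrix.range_cons, Set.insert_def]
    ext; simp; tauto
  rw [hset] at hr
  have key := AffineIndependent.convexHull_inter hr (t₁ := (hfin e he).toFinset)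
    (t₂ := (hfin e' he').toFinset)
    (by
      intro x hx
      simp only [Set.Finite.mem_toFinset] at hx
      obtain ⟨u, hu, rfl⟩ := hx
      rcases he hu with rfl | rfl | rfl <;> simp)
    (by
      intro x hx
      simp only [Set.Finite.mem_toFinset] at hx
      obtain ⟨u, hu, rfl⟩ := hx
      rcases he' hu with rfl | rfl | rfl <;> simp)
  rw [Set.Finite.coe_toFinset, Set.Finite.coe_toFinset] at key
  rw [← key, hinj.image_inter he he']

/-! ### Stacked triangulations with positive faces are planar -/

section Stacking

variable {V : Type*}

/-- Faces of a triangulation, listed counterclockwise, after a vertex `v` has been inserted into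
the face `x y z`. -/
def subdivide (F : Set (V × V × V)) (x y z v : V) : Set (V × V × V) :=
  (F \ {(x, y, z)}) ∪ {(v, y, z), (x, v, z), (x, y, v)}

/-- `Stacked G a b c s F`: the subgraph of `G` induced by `s` arises from the triangle `a b c` by
repeatedly inserting a vertex into a face; `F` is the set of the resulting inner faces. -/
inductive Stacked (G : SimpleGraph V) (a b c : V) : Set V → Set (V × V × V) → Prop
  | base (hab : G.Adj a b) (hbc : G.Adj b c) (hca : G.Adj c a) :
      Stacked G a b c {a, b, c} {(a, b, c)}
  | step (s : Set V) (F : Set (V × V × V)) (x y z v : V) (h : Stacked G a b c s F)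
      (hf : (x, y, z) ∈ F) (hv : v ∉ s) (hadj : ∀ u ∈ s, G.Adj v u ↔ u = x ∨ u = y ∨ u = z) :
      Stacked G a b c (insert v s) (subdivide F x y z v)

/-- The open triangle drawn for a face. -/
def openTriangle (p : V → Plane) (f : V × V × V) : Set Plane :=
  {w | Inside (p f.1) (p f.2.1) (p f.2.2) w}

/-- All faces are drawn with positive orientation. -/
def Positive (p : V → Plane) (F : Set (V × V × V)) : Prop :=
  ∀ f ∈ F, 0 < orient (p f.1) (p f.2.1) (p f.2.2)

lemma positive_subdivide {p : V → Plane} {F : Set (V × V × V)} {x y z v : V} :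
    Positive p (subdivide F x y z v) ↔
      Positive p (F \ {(x, y, z)}) ∧ Inside (p x) (p y) (p z) (p v) := by
  constructor
  · intro h
    exact ⟨fun f hf => h f (Or.inl hf), h (v, y, z) (Or.inr (by simp)),
      h (x, v, z) (Or.inr (by simp)), h (x, y, v) (Or.inr (by simp))⟩
  · rintro ⟨h, h1, h2, h3⟩ f (hf | rfl | rfl | rfl)
    exacts [h f hf, h1, h2, h3]

lemma Positive.of_subdivide {p : V → Plane} {F : Set (V × V × V)} {x y z v : V}
    (h : Positive p (subdivide F x y z v)) : Positive p F := by
  obtain ⟨h1, h2⟩ := positive_subdivide.1 h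
  intro f hf
  by_cases hfx : f = (x, y, z)
  · subst hfx; exact h2.pos
  · exact h1 f ⟨hf, hfx⟩

/-- Vertex sets of the vertices and edges of the subgraph induced by `s`. -/
def IsCell (G : SimpleGraph V) (s e : Set V) : Prop :=
  ∃ u ∈ s, ∃ v ∈ s, (u = v ∨ G.Adj u v) ∧ e = {u, v}

lemma IsCell.subset {G : SimpleGraph V} {s e : Set V} (h : IsCell G s e) : e ⊆ s := by
  obtain ⟨u, hu, v, hv, -, rfl⟩ := h
  rintro w (rfl | rfl) <;> assumption

lemma IsCell.of_insert {G : SimpleGraph V} {s e : Set V} {v x y z : V}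
    (hadj : ∀ u ∈ s, G.Adj v u ↔ u = x ∨ u = y ∨ u = z) (h : IsCell G (insert v s) e) :
    IsCell G s e ∨ e = {v} ∨ ∃ u, (u = x ∨ u = y ∨ u = z) ∧ e = {v, u} := by
  obtain ⟨u, hu, w, hw, h, rfl⟩ := h
  rcases hu with rfl | hu <;> rcases hw with rfl | hw
  · exact Or.inr (Or.inl (by simp))
  · rcases h with rfl | h
    · exact Or.inr (Or.inl (by simp))
    · exact Or.inr (Or.inr ⟨w, (hadj w hw).1 h, rfl⟩)
  · rcases h with rfl | h
    · exact Or.inr (Or.inl (by simp))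
    · exact Or.inr (Or.inr ⟨u, (hadj u hu).1 h.symm, Set.pair_comm _ _⟩)
  · exact Or.inl ⟨u, hu, w, hw, h, rfl⟩

/-- What a drawing with positively oriented faces satisfies: cells meet in common subcells, and the
open faces are disjoint from the cells, from each other, and from the outside of the root. -/
structure StackInvariant (G : SimpleGraph V) (a b c : V) (s : Set V) (F : Set (V × V × V))
    (p : V → Plane) : Prop where
  root : a ∈ s ∧ b ∈ s ∧ c ∈ s
  face_mem : ∀ x y z, (x, y, z) ∈ F → x ∈ s ∧ y ∈ s ∧ z ∈ s
  face_adj : ∀ x y z, (x, y, z) ∈ F → G.Adj x y ∧ G.Adj y z ∧ G.Adj z x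
  face_subset : ∀ f ∈ F, openTriangle p f ⊆ openTriangle p (a, b, c)
  face_disjoint : ∀ f ∈ F, ∀ g ∈ F, f ≠ g → Disjoint (openTriangle p f) (openTriangle p g)
  cell_face : ∀ e, IsCell G s e → ∀ f ∈ F,
    Disjoint (convexHull ℝ (p '' e)) (openTriangle p f)
  cell_cell : ∀ e e', IsCell G s e → IsCell G s e' →
    convexHull ℝ (p '' e) ∩ convexHull ℝ (p '' e') ⊆ convexHull ℝ (p '' (e ∩ e'))
  inner : ∀ v ∈ s, v ≠ a → v ≠ b → v ≠ c → p v ∈ openTriangle p (a, b, c)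
  root_pos : 0 < orient (p a) (p b) (p c)

/-- Substituting the weights of `v` in `a b c` into those of `w` in `v b c` gives the weights of `w`
in `a b c` as sums of positive terms, up to the factor `orient v b c`. -/
lemma Inside.trans_left {a b c v w : Plane} (hv : Inside a b c v) (hw : Inside v b c w) :
    Inside a b c w := by
  have hD := hv.pos
  obtain ⟨h1, h2, h3⟩ := hv
  have hp := hw.pos
  obtain ⟨k1, k2, k3⟩ := hw
  refine ⟨k1, ?_, ?_⟩
  · have : orient v b c * orient a w c = orient w b c * orient a v c +
        orient v w c * orient a b c := by simp only [orient_eq]; ring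
    have : 0 < orient v b c * orient a w c := by rw [this]; positivity
    exact (pos_iff_pos_of_mul_pos this).1 h1
  · have : orient v b c * orient a b w = orient w b c * orient a b v +
        orient v b w * orient a b c := by simp only [orient_eq]; ring
    have : 0 < orient v b c * orient a b w := by rw [this]; positivity
    exact (pos_iff_pos_of_mul_pos this).1 h1

lemma Inside.trans_middle {a b c v w : Plane} (hv : Inside a b c v) (hw : Inside a v c w) :
    Inside a b c w :=
  inside_rotate.1 (hv.rotate.trans_left hw.rotate)

lemma Inside.trans_right {a b c v w : Plane} (hv : Inside a b c v) (hw : Inside a b v w) :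
    Inside a b c w :=
  (hv.rotate.rotate.trans_left hw.rotate.rotate).rotate

lemma subdivide_subset {p : V → Plane} {F : Set (V × V × V)} {x y z v : V}
    (hf : (x, y, z) ∈ F) (hv : Inside (p x) (p y) (p z) (p v)) :
    ∀ f ∈ subdivide F x y z v, ∃ g ∈ F, openTriangle p f ⊆ openTriangle p g := by
  rintro f (hf | rfl | rfl | rfl)
  · exact ⟨f, hf.1, subset_rfl⟩
  · exact ⟨_, hf, fun w hw => hv.trans_left hw⟩
  · exact ⟨_, hf, fun w hw => hv.trans_middle hw⟩
  · exact ⟨_, hf, fun w hw => hv.trans_right hw⟩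

lemma not_inside_of_mem_segment_left {a b c x : Plane} (h : x ∈ segment ℝ a b) :
    ¬ Inside a b c x := fun hi => by
  have := orient_eq_zero_of_mem_segment h
  exact hi.2.2.ne' this

lemma not_inside_of_mem_segment {a b c x : Plane}
    (h : x ∈ segment ℝ a b ∨ x ∈ segment ℝ b c ∨ x ∈ segment ℝ c a) :
    ¬ Inside a b c x := by
  rcases h with h | h | h
  · exact not_inside_of_mem_segment_left h
  · exact fun hi => not_inside_of_mem_segment_left h hi.rotate
  · exact fun hi => not_inside_of_mem_segment_left h hi.rotate.rotate

/-- The segment from an inner point to a vertex avoids the three smaller open triangles. -/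
lemma not_inside_subdivide {a b c v x : Plane} (hv : Inside a b c v) (hx : x ∈ segment ℝ v a) :
    ¬ Inside v b c x ∧ ¬ Inside a v c x ∧ ¬ Inside a b v x := by
  refine ⟨fun h => ?_, fun h => ?_, fun h => ?_⟩
  · obtain ⟨t, h0, h1, ht⟩ := mem_segment_iff_coord.1 hx
    have := h.2.2
    rw [orient_lineMap_right _ _ _ _ _ t ht, orient_self_outer, orient_rotate a v b,
      orient_swap_right] at this
    nlinarith [hv.2.2]
  · rw [segment_symm] at hx
    exact not_inside_of_mem_segment (Or.inl hx) h
  · exact not_inside_of_mem_segment (Or.inr (Or.inr hx)) h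

lemma not_inside_subdivide' {a b c v x : Plane} (hv : Inside a b c v)
    (hx : x ∈ segment ℝ v a ∨ x ∈ segment ℝ v b ∨ x ∈ segment ℝ v c) :
    ¬ Inside v b c x ∧ ¬ Inside a v c x ∧ ¬ Inside a b v x := by
  rcases hx with hx | hx | hx
  · exact not_inside_subdivide hv hx
  · obtain ⟨h1, h2, h3⟩ := not_inside_subdivide hv.rotate hx
    exact ⟨fun h => h3 h.rotate, fun h => h1 h.rotate, fun h => h2 h.rotate⟩
  · obtain ⟨h1, h2, h3⟩ := not_inside_subdivide hv.rotate.rotate hx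
    exact ⟨fun h => h2 h.rotate.rotate, fun h => h3 h.rotate.rotate, fun h => h1 h.rotate.rotate⟩

lemma inside_or_eq_of_mem_segment' {p : V → Plane} {x y z u v : V} {w : Plane}
    (hv : Inside (p x) (p y) (p z) (p v)) (hu : u = x ∨ u = y ∨ u = z)
    (hw : w ∈ segment ℝ (p v) (p u)) : Inside (p x) (p y) (p z) w ∨ w = p u := by
  rcases hu with rfl | rfl | rfl
  · exact inside_or_eq_of_mem_segment hv hw
  · exact (inside_or_eq_of_mem_segment hv.rotate hw).imp_left inside_rotate.1
  · exact (inside_or_eq_of_mem_segment hv.rotate.rotate hw).imp_left Inside.rotate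

lemma convexHull_image_pair (p : V → Plane) (u v : V) :
    convexHull ℝ (p '' {u, v}) = segment ℝ (p u) (p v) := by
  rw [Set.image_pair, convexHull_pair]

lemma convexHull_image_single (p : V → Plane) (u : V) :
    convexHull ℝ (p '' {u}) = {p u} := by
  rw [Set.image_singleton, convexHull_singleton]

/-- Positivity of the faces is a local condition that forces global planarity. By induction, the
face receiving a new vertex is free of old cells, so the new edges can meet old cells only at its
corners. -/
theorem Stacked.invariant {G : SimpleGraph V} {a b c : V} {s : Set V} {F : Set (V × V × V)}
    (h : Stacked G a b c s F) {p : V → Plane} (hp : Positive p F) :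
    StackInvariant G a b c s F p := by
  induction h with
  | base hab hbc hca =>
    have hD : 0 < orient (p a) (p b) (p c) := hp _ rfl
    refine ⟨by simp, ?_, ?_, ?_, ?_, ?_, ?_, ?_, hD⟩
    · rintro x y z h
      simp only [Set.mem_singleton_iff, Prod.mk.injEq] at h
      obtain ⟨rfl, rfl, rfl⟩ := h
      simp
    · rintro x y z h
      simp only [Set.mem_singleton_iff, Prod.mk.injEq] at h
      obtain ⟨rfl, rfl, rfl⟩ := h
      exact ⟨hab, hbc, hca⟩
    · rintro f rfl; exact subset_rfl
    · rintro f rfl g rfl h; exact absurd rfl h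
    · rintro e ⟨u, hu, v, hv, -, rfl⟩ f rfl
      rw [convexHull_image_pair, Set.disjoint_left]
      intro w hw
      apply not_inside_of_mem_segment
      rcases hu with rfl | rfl | rfl <;> rcases hv with rfl | rfl | rfl <;>
        simp only [segment_same, Set.mem_singleton_iff] at hw ⊢ <;>
        first
        | (subst hw; simp [left_mem_segment, right_mem_segment])
        | (simp only [hw, true_or, or_true])
        | (rw [segment_symm] at hw; simp only [hw, true_or, or_true])
    · intro e e' he he'
      exact convexHull_image_inter hD.ne' he.subset he'.subset
    · rintro v (rfl | rfl | rfl) <;> simp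
  | step s F x y z v h hf hv hadj ih =>
    have I := ih hp.of_subdivide
    have hin := (positive_subdivide.1 hp).2
    obtain ⟨hx, hy, hz⟩ := I.face_mem x y z hf
    obtain ⟨hxy, hyz, hzx⟩ := I.face_adj x y z hf
    have hvx : G.Adj v x := (hadj x hx).2 (by simp)
    have hvy : G.Adj v y := (hadj y hy).2 (by simp)
    have hvz : G.Adj v z := (hadj z hz).2 (by simp)
    have hvtri : p v ∈ openTriangle p (x, y, z) := hin
    -- points of new cells
    have hnew : ∀ e, (e = {v} ∨ ∃ u, (u = x ∨ u = y ∨ u = z) ∧ e = {v, u}) →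
        ∀ w ∈ convexHull ℝ (p '' e), w ∈ openTriangle p (x, y, z) ∨
          ∃ u ∈ e, (u = x ∨ u = y ∨ u = z) ∧ w = p u := by
      rintro e (rfl | ⟨u, hu, rfl⟩) w hw
      · rw [convexHull_image_single] at hw
        exact Or.inl (hw ▸ hvtri)
      · rw [convexHull_image_pair] at hw
        rcases inside_or_eq_of_mem_segment' hin hu hw with h | h
        · exact Or.inl h
        · exact Or.inr ⟨u, by simp, hu, h⟩
    have hmem : ∀ u, (u = x ∨ u = y ∨ u = z) → u ∈ s := by
      rintro u (rfl | rfl | rfl) <;> assumption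
    have hsing : ∀ u ∈ s, IsCell G s {u} := fun u hu => ⟨u, hu, u, hu, Or.inl rfl, by simp⟩
    -- A common point of a new and an old cell cannot lie in the open face, so it is a corner. A
    -- corner is itself an old cell, to which the induction hypothesis applies.
    have hmix : ∀ e e', (e = {v} ∨ ∃ u, (u = x ∨ u = y ∨ u = z) ∧ e = {v, u}) →
        IsCell G s e' → ∀ w ∈ convexHull ℝ (p '' e), w ∈ convexHull ℝ (p '' e') →
        w ∈ convexHull ℝ (p '' (e ∩ e')) := by
      intro e e' he he' w hw hw'
      rcases hnew e he w hw with h | ⟨u, hue, hu, rfl⟩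
      · exact absurd h (Set.disjoint_left.1 (I.cell_face e' he' _ hf) hw')
      · have := I.cell_cell {u} e' (hsing u (hmem u hu)) he'
          ⟨by rw [convexHull_image_single]; rfl, hw'⟩
        exact convexHull_mono (Set.image_mono (Set.inter_subset_inter_left e'
          (Set.singleton_subset_iff.2 hue))) this
    refine ⟨⟨Or.inr I.root.1, Or.inr I.root.2.1, Or.inr I.root.2.2⟩, ?_, ?_, ?_, ?_, ?_, ?_, ?_,
      I.root_pos⟩
    · rintro x' y' z' (h | h | h | h)
      · obtain ⟨h1, h2, h3⟩ := I.face_mem _ _ _ h.1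
        exact ⟨Or.inr h1, Or.inr h2, Or.inr h3⟩
      all_goals
        simp only [Set.mem_singleton_iff, Prod.mk.injEq] at h
        obtain ⟨rfl, rfl, rfl⟩ := h
        simp [hx, hy, hz]
    · rintro x' y' z' (h | h | h | h)
      · exact I.face_adj _ _ _ h.1
      all_goals
        simp only [Set.mem_singleton_iff, Prod.mk.injEq] at h
        obtain ⟨rfl, rfl, rfl⟩ := h
      · exact ⟨hvy, hyz, hvz.symm⟩
      · exact ⟨hvx.symm, hvz, hzx⟩
      · exact ⟨hxy, hvy.symm, hvx⟩
    · intro f hf'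
      obtain ⟨g, hg, hfg⟩ := subdivide_subset hf hin f hf'
      exact hfg.trans (I.face_subset g hg)
    -- Two of the small triangles lie on opposite sides of the line through their common edge.
    · have d1 : Disjoint (openTriangle p (v, y, z)) (openTriangle p (x, v, z)) := by
        rw [Set.disjoint_left]; intro w h1 h2
        have e1 := h1.2.1; have e2 := h2.1
        simp only at e1 e2
        rw [orient_swap] at e1; linarith
      have d2 : Disjoint (openTriangle p (v, y, z)) (openTriangle p (x, y, v)) := by
        rw [Set.disjoint_left]; intro w h1 h2
        have e1 := h1.2.2; have e2 := h2.1
        simp only at e1 e2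
        rw [← orient_rotate, orient_swap] at e1; linarith
      have d3 : Disjoint (openTriangle p (x, v, z)) (openTriangle p (x, y, v)) := by
        rw [Set.disjoint_left]; intro w h1 h2
        have e1 := h1.2.2; have e2 := h2.2.1
        simp only at e1 e2
        rw [orient_swap_right] at e1; linarith
      have dold : ∀ f ∈ F \ {(x, y, z)}, ∀ g, g = (v, y, z) ∨ g = (x, v, z) ∨ g = (x, y, v) →
          Disjoint (openTriangle p f) (openTriangle p g) := by
        intro f hf' g hg
        refine (I.face_disjoint f hf'.1 _ hf hf'.2).mono_right ?_
        rcases hg with rfl | rfl | rfl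
        exacts [fun w hw => hin.trans_left hw, fun w hw => hin.trans_middle hw,
          fun w hw => hin.trans_right hw]
      rintro f (hf' | hf') g (hg' | hg') hne
      · exact I.face_disjoint f hf'.1 g hg'.1 hne
      · exact dold f hf' g hg'
      · exact (dold g hg' f hf').symm
      · rcases hf' with rfl | rfl | rfl <;> rcases hg' with rfl | rfl | rfl <;>
          first
          | exact absurd rfl hne
          | assumption
          | (apply Disjoint.symm; assumption)
    · intro e he f hf'
      rcases he.of_insert hadj with he | he
      · obtain ⟨g, hg, hfg⟩ := subdivide_subset hf hin f hf'
        exact (I.cell_face e he g hg).mono_right hfg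
      · rw [Set.disjoint_left]
        intro w hw hwf
        rcases hf' with hf' | hf'
        · rcases hnew e he w hw with h | ⟨u, -, hu, rfl⟩
          · exact Set.disjoint_left.1 (I.face_disjoint f hf'.1 _ hf hf'.2) hwf h
          · refine Set.disjoint_left.1 (I.cell_face {u} (hsing u (hmem u hu)) f hf'.1) ?_ hwf
            rw [convexHull_image_single]; rfl
        · have hw' : w ∈ segment ℝ (p v) (p x) ∨ w ∈ segment ℝ (p v) (p y) ∨
              w ∈ segment ℝ (p v) (p z) := by
            rcases he with rfl | ⟨u, hu, rfl⟩
            · rw [convexHull_image_single] at hw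
              left; rw [Set.mem_singleton_iff.1 hw]; exact left_mem_segment _ _ _
            · rw [convexHull_image_pair] at hw
              rcases hu with rfl | rfl | rfl <;> simp [hw]
          obtain ⟨k1, k2, k3⟩ := not_inside_subdivide' hin hw'
          rcases hf' with rfl | rfl | rfl
          exacts [k1 hwf, k2 hwf, k3 hwf]
    · rintro e e' he he' w ⟨hw, hw'⟩
      rcases he.of_insert hadj with he | he <;> rcases he'.of_insert hadj with he' | he'
      · exact I.cell_cell e e' he he' ⟨hw, hw'⟩
      · rw [Set.inter_comm]
        exact hmix e' e he' he w hw' hw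
      · exact hmix e e' he he' w hw hw'
      -- Each new cell uses at most one corner besides `v`, so two of them are faces of one small
      -- triangle.
      · have key : (e ⊆ {v, y, z} ∧ e' ⊆ {v, y, z}) ∨ (e ⊆ {x, v, z} ∧ e' ⊆ {x, v, z}) ∨
            (e ⊆ {x, y, v} ∧ e' ⊆ {x, y, v}) := by
          rcases he with rfl | ⟨u, rfl | rfl | rfl, rfl⟩ <;>
            rcases he' with rfl | ⟨u, rfl | rfl | rfl, rfl⟩ <;>
            simp [Set.insert_subset_iff]
        obtain ⟨k1, k2, k3⟩ := hin
        rcases key with ⟨h1, h2⟩ | ⟨h1, h2⟩ | ⟨h1, h2⟩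
        · exact convexHull_image_inter k1.ne' h1 h2 ⟨hw, hw'⟩
        · exact convexHull_image_inter k2.ne' h1 h2 ⟨hw, hw'⟩
        · exact convexHull_image_inter k3.ne' h1 h2 ⟨hw, hw'⟩
    · rintro u (rfl | hu) h1 h2 h3
      · exact I.face_subset _ hf hvtri
      · exact I.inner u hu h1 h2 h3

lemma StackInvariant.isPlanarDrawing {G : SimpleGraph V} {a b c : V} {F : Set (V × V × V)}
    {p : V → Plane} (I : StackInvariant G a b c Set.univ F p) : IsPlanarDrawing G p := by
  have hsing : ∀ u, IsCell G Set.univ {u} := fun u =>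
    ⟨u, trivial, u, trivial, Or.inl rfl, by simp⟩
  have hpair : ∀ u v, G.Adj u v → IsCell G Set.univ {u, v} := fun u v h =>
    ⟨u, trivial, v, trivial, Or.inr h, rfl⟩
  refine ⟨fun u v h => ?_, fun u v w huv hwu hwv hw => ?_, ?_⟩
  · by_contra hne
    have : p u ∈ _ := I.cell_cell {u} {v} (hsing u) (hsing v)
      ⟨by rw [convexHull_image_single]; rfl, by rw [convexHull_image_single, h]; rfl⟩
    rw [Set.singleton_inter_eq_empty.2 (by simpa using hne)] at this
    simp at this
  · have : p w ∈ _ := I.cell_cell {w} {u, v} (hsing w) (hpair u v huv)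
      ⟨by rw [convexHull_image_single]; rfl, by rw [convexHull_image_pair]; exact hw⟩
    rw [Set.singleton_inter_eq_empty.2 (by simp [hwu, hwv])] at this
    simp at this
  · rintro u v x y huv hxy hne w ⟨h1, h2⟩
    have := I.cell_cell {u, v} {x, y} (hpair u v huv) (hpair x y hxy)
      ⟨by rwa [convexHull_image_pair], by rwa [convexHull_image_pair]⟩
    -- Distinct edges share at most one end, so the convex hull of their common ends adds no point.
    have hsub : (({u, v} : Set V) ∩ {x, y}).Subsingleton := by
      rintro k ⟨hk1, hk2⟩ l ⟨hl1, hl2⟩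
      by_contra hkl
      apply hne
      simp only [Set.mem_insert_iff, Set.mem_singleton_iff] at hk1 hk2 hl1 hl2
      rw [Sym2.eq_iff]
      grind
    rwa [(hsub.image p).convex.convexHull_eq] at this

end Stacking

/-! ### The cyclic order of the edges around a vertex -/

lemma plane_cross_self (x : Plane) : cross x x = 0 := by simp only [cross]; ring

lemma plane_cross_swap (x y : Plane) : cross y x = -cross x y := by simp only [cross]; ring

lemma cross_sub_sub (o x y : Plane) : cross (x - o) (y - o) = orient o x y := rfl

lemma isCCW_rotate {x y z : Plane} : IsCCW y z x ↔ IsCCW x y z := by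
  unfold IsCCW; tauto

lemma not_isCCW_left (x z : Plane) : ¬ IsCCW x x z := by
  unfold IsCCW
  rw [plane_cross_self, plane_cross_swap x z]
  rintro (⟨h, -⟩ | ⟨h, h'⟩ | ⟨-, h⟩) <;> linarith

lemma not_isCCW_right (x z : Plane) : ¬ IsCCW z x x := fun h =>
  not_isCCW_left x z (isCCW_rotate.2 h)

lemma not_isCCW_outer (x z : Plane) : ¬ IsCCW x z x := fun h =>
  not_isCCW_left x z (isCCW_rotate.1 h)

/-- `X` lies in the open convex sector from `B` to `C`. -/
def InSector (B C X : Plane) : Prop :=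
  0 < cross B C ∧ ∃ β γ : ℝ, 0 < β ∧ 0 < γ ∧ X = β • B + γ • C

/-- `Y` does not lie in the closed convex sector from `B` to `C`. -/
def OffSector (B C Y : Plane) : Prop := cross B Y < 0 ∨ cross Y C < 0

lemma cross_combo_left (β γ : ℝ) (B C Y : Plane) :
    cross (β • B + γ • C) Y = β * cross B Y + γ * cross C Y := by
  simp [cross]; ring

/-- Turning `X` back to `B` inside the sector passes neither `Y` nor `Z`, so the cyclic order does
not change. -/
lemma InSector.isCCW_iff {B C X Y Z : Plane} (h : InSector B C X) (hY : OffSector B C Y)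
    (hZ : OffSector B C Z) : IsCCW X Y Z ↔ IsCCW B Y Z := by
  obtain ⟨hD, β, γ, hβ, hγ, rfl⟩ := h
  -- A Plücker relation: it determines the sign of `cross Y Z` from the four products of `X` and `B`
  -- with `Y` and `Z`, which leaves a case analysis on real numbers.
  have hW : cross Y Z * (γ * cross B C) =
      cross (β • B + γ • C) Z * cross B Y - cross (β • B + γ • C) Y * cross B Z := by
    simp [cross]; ring
  have hγD : 0 < γ * cross B C := by positivity
  unfold OffSector at hY hZ
  have hP : 0 ≤ cross B Y → 0 < cross (β • B + γ • C) Y := by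
    intro h0
    rw [cross_combo_left]
    rcases hY with h | h
    · linarith
    · rw [plane_cross_swap C Y] at h
      have : 0 < cross C Y := by linarith
      positivity
  have hQ : 0 ≤ cross B Z → 0 < cross (β • B + γ • C) Z := by
    intro h0
    rw [cross_combo_left]
    rcases hZ with h | h
    · linarith
    · rw [plane_cross_swap C Z] at h
      have : 0 < cross C Z := by linarith
      positivity
  unfold IsCCW
  rw [plane_cross_swap (β • B + γ • C) Z, plane_cross_swap B Z]
  generalize cross (β • B + γ • C) Y = P at *
  generalize cross (β • B + γ • C) Z = Q at *
  generalize cross B Y = y at *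
  generalize cross B Z = z at *
  generalize cross Y Z = w at *
  generalize γ * cross B C = k at *
  clear hY hZ
  have hw : 0 < w ↔ 0 < Q * y - P * z := by
    rw [← hW]; exact ⟨fun h => by positivity, fun h => (pos_iff_pos_of_mul_pos h).2 hγD⟩
  rw [hw]
  constructor
  · rintro (⟨h1, h2⟩ | ⟨h1, h2⟩ | ⟨h1, h2⟩)
    · by_cases hz : 0 ≤ z
      · refine Or.inl ⟨?_, h2⟩
        by_contra hy
        nlinarith [hQ hz, mul_nonneg h1.le hz, mul_nonneg (hQ hz).le (not_lt.1 hy |> neg_nonneg.2)]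
      · exact Or.inr (Or.inl ⟨h2, by linarith⟩)
    · refine Or.inr (Or.inl ⟨h1, ?_⟩)
      by_contra hz
      linarith [hQ (by linarith)]
    · have hz : z < 0 := by
        by_contra hz
        linarith [hQ (by linarith)]
      by_cases hy : 0 < y
      · exact Or.inr (Or.inr ⟨by linarith, hy⟩)
      · exact Or.inr (Or.inl ⟨by nlinarith, by linarith⟩)
  · rintro (⟨h1, h2⟩ | ⟨h1, h2⟩ | ⟨h1, h2⟩)
    · exact Or.inl ⟨hP h1.le, h2⟩
    · by_cases hq : Q < 0
      · exact Or.inr (Or.inl ⟨h1, by linarith⟩)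
      · refine Or.inl ⟨?_, h1⟩
        by_contra hp
        have hy : y < 0 := by
          by_contra hy
          linarith [hP (by linarith)]
        nlinarith
    · have := hP h2.le
      by_cases hq : Q < 0
      · exact Or.inr (Or.inr ⟨by linarith, this⟩)
      · exact Or.inl ⟨this, by nlinarith⟩

/-- Counterclockwise, `X` comes between `B` and `C` with `Y` outside that interval. These four truth
values are thus the same in every drawing. -/
lemma InSector.isCCW_off {B C X Y : Plane} (h : InSector B C X) (hY : OffSector B C Y) :
    IsCCW X C Y ∧ ¬ IsCCW X B Y ∧ ¬ IsCCW X Y C ∧ IsCCW X Y B := by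
  obtain ⟨hD, β, γ, hβ, hγ, rfl⟩ := h
  unfold OffSector at hY
  unfold IsCCW
  rw [plane_cross_swap (β • B + γ • C) Y, plane_cross_swap (β • B + γ • C) C, plane_cross_swap (β • B + γ • C) B,
    plane_cross_swap B Y, cross_combo_left, cross_combo_left, cross_combo_left, plane_cross_self, plane_cross_self,
    plane_cross_swap B C]
  rw [plane_cross_swap C Y] at hY ⊢
  generalize cross B Y = y at *
  generalize cross C Y = z at *
  generalize cross B C = D at *
  have h1 : 0 < β * D := by positivity
  have h2 : 0 < γ * D := by positivity
  have h3 : y < 0 → z ≤ 0 → β * y + γ * z < 0 := fun a b => by nlinarith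
  have h4 : 0 ≤ y → 0 < z → 0 < β * y + γ * z := fun a b => by positivity
  refine ⟨?_, ?_, ?_, ?_⟩
  · rcases lt_or_ge 0 z with hz | hz
    · exact Or.inl ⟨by linarith, hz⟩
    · exact Or.inr (Or.inr ⟨by linarith [h3 (by rcases hY with h | h <;> linarith) hz],
        by linarith⟩)
  · rintro (⟨a, b⟩ | ⟨a, b⟩ | ⟨a, b⟩)
    · linarith
    · linarith [h4 a.le (by rcases hY with h | h <;> linarith)]
    · linarith
  · rintro (⟨a, b⟩ | ⟨a, b⟩ | ⟨a, b⟩)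
    · linarith [h3 (by rcases hY with h | h <;> linarith) (by linarith)]
    · linarith
    · linarith
  · rcases lt_or_ge y 0 with hy | hy
    · exact Or.inr (Or.inl ⟨by linarith, by linarith⟩)
    · exact Or.inr (Or.inr ⟨by linarith, h4 hy (by rcases hY with h | h <;> linarith)⟩)

lemma InSector.isCCW_ends {B C X : Plane} (h : InSector B C X) :
    IsCCW X C B ∧ ¬ IsCCW X B C := by
  obtain ⟨hD, β, γ, hβ, hγ, rfl⟩ := h
  have h1 : 0 < β * cross B C := by positivity
  have h2 : 0 < γ * cross B C := by positivity
  unfold IsCCW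
  rw [plane_cross_swap (β • B + γ • C) C, plane_cross_swap (β • B + γ • C) B, cross_combo_left,
    cross_combo_left, plane_cross_self, plane_cross_self, plane_cross_swap B C]
  constructor
  · exact Or.inr (Or.inr ⟨by linarith, by linarith⟩)
  · rintro (⟨a, b⟩ | ⟨a, b⟩ | ⟨a, b⟩) <;> linarith

section Rotation

variable {V : Type*}

/-- The edges at `o` to the vertices `x`, `y`, `z` leave `o` in this counterclockwise order. -/
def CCWAt (p : V → Plane) (o x y z : V) : Prop := IsCCW (p x - p o) (p y - p o) (p z - p o)

/-- Two drawings that agree on the cyclic order at `o` still agree after an edge enters a sector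
that no other edge meets: triples involving an end of the sector are decided outright, and in the
others `v` can be replaced by `b`. -/
lemma ccwAt_iff_of_sector {p q : V → Plane} {o b c v : V} {N : Set V}
    (hpv : InSector (p b - p o) (p c - p o) (p v - p o))
    (hqv : InSector (q b - q o) (q c - q o) (q v - q o))
    (hp : ∀ u ∈ N, u ≠ b → u ≠ c → OffSector (p b - p o) (p c - p o) (p u - p o))
    (hq : ∀ u ∈ N, u ≠ b → u ≠ c → OffSector (q b - q o) (q c - q o) (q u - q o))
    (hb : b ∈ N)
    (ih : ∀ x ∈ N, ∀ y ∈ N, ∀ z ∈ N, CCWAt p o x y z ↔ CCWAt q o x y z) :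
    ∀ x ∈ insert v N, ∀ y ∈ insert v N, ∀ z ∈ insert v N,
      CCWAt p o x y z ↔ CCWAt q o x y z := by
  -- By cyclic symmetry it is enough to treat triples that begin with `v`.
  have key : ∀ y ∈ insert v N, ∀ z ∈ insert v N, CCWAt p o v y z ↔ CCWAt q o v y z := by
    rintro y (rfl | hy) z hz
    · simp only [CCWAt, not_isCCW_left]
    rcases hz with rfl | hz
    · simp only [CCWAt, not_isCCW_outer]
    by_cases hyz : y = z
    · subst hyz
      simp only [CCWAt, not_isCCW_right]
    by_cases hyb : y = b
    · subst hyb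
      by_cases hzc : z = c
      · subst hzc
        simp only [CCWAt, hpv.isCCW_ends.2, hqv.isCCW_ends.2]
      · have h1 := hpv.isCCW_off (hp z hz (Ne.symm hyz) hzc)
        have h2 := hqv.isCCW_off (hq z hz (Ne.symm hyz) hzc)
        simp only [CCWAt, h1.2.1, h2.2.1]
    by_cases hyc : y = c
    · subst hyc
      by_cases hzb : z = b
      · subst hzb
        simp only [CCWAt, hpv.isCCW_ends.1, hqv.isCCW_ends.1]
      · have h1 := hpv.isCCW_off (hp z hz hzb (Ne.symm hyz))
        have h2 := hqv.isCCW_off (hq z hz hzb (Ne.symm hyz))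
        simp only [CCWAt, h1.1, h2.1]
    have hpy := hp y hy hyb hyc
    have hqy := hq y hy hyb hyc
    by_cases hzb : z = b
    · subst hzb
      simp only [CCWAt, (hpv.isCCW_off hpy).2.2.2, (hqv.isCCW_off hqy).2.2.2]
    by_cases hzc : z = c
    · subst hzc
      simp only [CCWAt, (hpv.isCCW_off hpy).2.2.1, (hqv.isCCW_off hqy).2.2.1]
    unfold CCWAt
    rw [hpv.isCCW_iff hpy (hp z hz hzb hzc), hqv.isCCW_iff hqy (hq z hz hzb hzc)]
    exact ih b hb y hy z hz
  have rot : ∀ (r : V → Plane) x y z, CCWAt r o x y z ↔ CCWAt r o y z x :=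
    fun r x y z => isCCW_rotate.symm
  intro x hx y hy z hz
  rcases hx with rfl | hx'
  · exact key y hy z hz
  rcases hy with rfl | hy'
  · rw [rot p, rot q]
    exact key z hz x (Or.inr hx')
  rcases hz with rfl | hz'
  · rw [← rot p, ← rot q]
    exact key x (Or.inr hx') y (Or.inr hy')
  exact ih x hx' y hy' z hz'

lemma Inside.inSector {a b c v : Plane} (h : Inside a b c v) :
    InSector (b - a) (c - a) (v - a) := by
  have hD := h.pos
  refine ⟨hD, orient a v c / orient a b c, orient a b v / orient a b c, div_pos h.2.1 hD,
    div_pos h.2.2 hD, ?_⟩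
  have hs := orient_add a b c v
  ext i
  have := orient_bary a b c v i
  simp only [PiLp.sub_apply, PiLp.add_apply, PiLp.smul_apply, smul_eq_mul]
  field_simp
  linear_combination -this + a i * hs

/-- Two edges leaving `o` in the same direction would put the end of the shorter one on the longer
one. -/
lemma StackInvariant.not_ray {G : SimpleGraph V} {a b c : V} {s : Set V}
    {F : Set (V × V × V)} {p : V → Plane} (I : StackInvariant G a b c s F p) {o u y : V}
    (ho : o ∈ s) (hu : u ∈ s) (hy : y ∈ s) (hou : G.Adj o u) (hoy : G.Adj o y) (huy : u ≠ y)
    {t : ℝ} (ht : 0 ≤ t) (h : ∀ i, p u i = (1 - t) * p o i + t * p y i) : False := by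
  have aux : ∀ k l, k ∈ s → l ∈ s → G.Adj o k → G.Adj o l → k ≠ l →
      p k ∈ segment ℝ (p o) (p l) → False := by
    intro k l hk hl hok hol hkl hmem
    have : p k ∈ _ := I.cell_cell {k} {o, l} ⟨k, hk, k, hk, Or.inl rfl, by simp⟩
      ⟨o, ho, l, hl, Or.inr hol, rfl⟩
      ⟨by rw [convexHull_image_single]; rfl, by rwa [convexHull_image_pair]⟩
    rw [Set.singleton_inter_eq_empty.2 (by simp [hok.ne', hkl])] at this
    simp at this
  rcases le_or_gt t 1 with h1 | h1
  · exact aux u y hu hy hou hoy huy (mem_segment_iff_coord.2 ⟨t, ht, h1, h⟩)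
  · refine aux y u hy hu hoy hou huy.symm (mem_segment_iff_coord.2 ⟨t⁻¹, by positivity,
      inv_le_one_of_one_le₀ h1.le, fun i => ?_⟩)
    rw [h i]; field_simp; ring

/-- An edge pointing into the sector of an empty face would enter the face near `o`; one pointing
along a side is excluded by `not_ray`. -/
lemma StackInvariant.offSector {G : SimpleGraph V} {a b c : V} {s : Set V}
    {F : Set (V × V × V)} {p : V → Plane} (I : StackInvariant G a b c s F p) {o y z u : V}
    (ho : o ∈ s) (hy : y ∈ s) (hz : z ∈ s) (hoy : G.Adj o y) (hoz : G.Adj o z)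
    (hD : 0 < orient (p o) (p y) (p z))
    (hF : ∀ e, IsCell G s e → ∀ w ∈ convexHull ℝ (p '' e), ¬ Inside (p o) (p y) (p z) w)
    (hu : u ∈ s) (hou : G.Adj o u) (huy : u ≠ y) (huz : u ≠ z) :
    OffSector (p y - p o) (p z - p o) (p u - p o) := by
  unfold OffSector
  rw [cross_sub_sub, cross_sub_sub]
  by_contra! hcon
  obtain ⟨h1, h2⟩ := hcon
  have hs := orient_add (p o) (p y) (p z) (p u)
  have hb := orient_bary (p o) (p y) (p z) (p u)
  rcases h1.eq_or_lt with h1 | h1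
  · refine I.not_ray ho hu hy hou hoy huy
      (t := orient (p o) (p u) (p z) / orient (p o) (p y) (p z)) (by positivity) fun i => ?_
    have := hb i
    rw [← h1] at this hs
    field_simp
    linear_combination -this + p o i * hs
  rcases h2.eq_or_lt with h2 | h2
  · refine I.not_ray ho hu hz hou hoz huz
      (t := orient (p o) (p y) (p u) / orient (p o) (p y) (p z)) (by positivity) fun i => ?_
    have := hb i
    rw [← h2] at this hs
    field_simp
    linear_combination -this + p o i * hs
  · set D := orient (p o) (p y) (p z) with hDdef
    set k := orient (p u) (p y) (p z) with hk
    -- Small enough that the weight `(1 - t) * D + t * k` of the corner `o` stays positive: `t * (D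
    -- + |k|) = D / 2`.
    set t : ℝ := D / (2 * (D + |k|)) with ht
    have hk0 := abs_nonneg k
    have hden : 0 < 2 * (D + |k|) := by positivity
    have ht0 : 0 < t := by positivity
    have ht1 : t ≤ 1 := by rw [ht, div_le_one hden]; linarith
    set w : Plane := !₂[(1 - t) * p o 0 + t * p u 0, (1 - t) * p o 1 + t * p u 1] with hw
    have hwi : ∀ i, w i = (1 - t) * p o i + t * p u i := by
      intro i; fin_cases i <;> simp [hw]
    refine hF {o, u} ⟨o, ho, u, hu, Or.inr hou, rfl⟩ w ?_ ⟨?_, ?_, ?_⟩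
    · rw [convexHull_image_pair]
      exact mem_segment_iff_coord.2 ⟨t, ht0.le, ht1, hwi⟩
    · rw [orient_lineMap_left _ _ _ _ _ t hwi, ← hDdef, ← hk]
      have e : t * (2 * (D + |k|)) = D := by rw [ht]; field_simp
      have : -(t * |k|) ≤ t * k := by nlinarith [neg_abs_le k]
      nlinarith
    · rw [orient_lineMap_middle _ _ _ _ _ t hwi, orient_self_left]
      simp; positivity
    · rw [orient_lineMap_right _ _ _ _ _ t hwi, orient_self_outer]
      simp; positivity

/-- An inserted vertex changes the rotation only at the three corners of its face, where its edge
enters the empty sector of that face. Its own three edges leave in the order of the corners. -/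
theorem Stacked.ccwAt_iff {G : SimpleGraph V} {a b c : V} {s : Set V} {F : Set (V × V × V)}
    (h : Stacked G a b c s F) {p q : V → Plane} (hp : Positive p F) (hq : Positive q F) :
    ∀ o ∈ s, ∀ x ∈ {u ∈ s | G.Adj o u}, ∀ y ∈ {u ∈ s | G.Adj o u}, ∀ z ∈ {u ∈ s | G.Adj o u},
      CCWAt p o x y z ↔ CCWAt q o x y z := by
  have tri : ∀ (p : V → Plane) (o x y z : V), Inside (p x) (p y) (p z) (p o) →
      (CCWAt p o x y z ∧ CCWAt p o y z x ∧ CCWAt p o z x y) ∧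
      ¬ CCWAt p o x z y ∧ ¬ CCWAt p o z y x ∧ ¬ CCWAt p o y x z := by
    intro p o x y z ⟨h1, h2, h3⟩
    unfold CCWAt IsCCW
    simp only [cross_sub_sub]
    have e1 := orient_swap_right (p o) (p y) (p z)
    have e2 := orient_swap_right (p o) (p z) (p x)
    have e3 := orient_swap_right (p o) (p x) (p y)
    have k2 : 0 < orient (p o) (p z) (p x) := by
      simp only [orient_eq] at h2 ⊢; linarith
    have k3 : 0 < orient (p o) (p x) (p y) := by
      simp only [orient_eq] at h3 ⊢; linarith
    refine ⟨⟨Or.inl ⟨k3, h1⟩, Or.inl ⟨h1, k2⟩, Or.inl ⟨k2, k3⟩⟩, ?_, ?_, ?_⟩ <;>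
      rintro (⟨a, b⟩ | ⟨a, b⟩ | ⟨a, b⟩) <;> linarith
  induction h with
  | base hab hbc hca =>
    -- every vertex has only two neighbours
    have key : ∀ o ∈ ({a, b, c} : Set V), ∀ x ∈ {u ∈ ({a, b, c} : Set V) | G.Adj o u},
        ∀ y ∈ {u ∈ ({a, b, c} : Set V) | G.Adj o u},
        ∀ z ∈ {u ∈ ({a, b, c} : Set V) | G.Adj o u}, x = y ∨ y = z ∨ x = z := by
      have ne1 := hab.ne
      have ne2 := hbc.ne
      have ne3 := hca.ne
      rintro o ho x ⟨hx, hox⟩ y ⟨hy, hoy⟩ z ⟨hz, hoz⟩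
      have := hox.ne; have := hoy.ne; have := hoz.ne
      simp only [Set.mem_insert_iff, Set.mem_singleton_iff] at ho hx hy hz
      grind
    intro o ho x hx y hy z hz
    rcases key o ho x hx y hy z hz with rfl | rfl | rfl
    · simp only [CCWAt, not_isCCW_left]
    · simp only [CCWAt, not_isCCW_right]
    · simp only [CCWAt, not_isCCW_outer]
  | step s F x y z v h hf hv hadj ih =>
    have Ip := h.invariant hp.of_subdivide
    have Iq := h.invariant hq.of_subdivide
    have inp := (positive_subdivide.1 hp).2
    have inq := (positive_subdivide.1 hq).2
    have ih := ih hp.of_subdivide hq.of_subdivide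
    obtain ⟨hx, hy, hz⟩ := Ip.face_mem x y z hf
    obtain ⟨hxy, hyz, hzx⟩ := Ip.face_adj x y z hf
    have hFp : ∀ e, IsCell G s e → ∀ w ∈ convexHull ℝ (p '' e), ¬ Inside (p x) (p y) (p z) w :=
      fun e he w hw hi => Set.disjoint_left.1 (Ip.cell_face e he _ hf) hw hi
    have hFq : ∀ e, IsCell G s e → ∀ w ∈ convexHull ℝ (q '' e), ¬ Inside (q x) (q y) (q z) w :=
      fun e he w hw hi => Set.disjoint_left.1 (Iq.cell_face e he _ hf) hw hi
    have sector : ∀ o k l, o ∈ s → k ∈ s → l ∈ s → G.Adj o k → G.Adj o l →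
        (∀ r : V → Plane, ∀ w, Inside (r o) (r k) (r l) w ↔ Inside (r x) (r y) (r z) w) →
        ∀ x ∈ insert v {u ∈ s | G.Adj o u}, ∀ y ∈ insert v {u ∈ s | G.Adj o u},
        ∀ z ∈ insert v {u ∈ s | G.Adj o u}, CCWAt p o x y z ↔ CCWAt q o x y z := by
      intro o k l ho hk hl hok hol hin
      have jp := (hin p _).2 inp
      have jq := (hin q _).2 inq
      refine ccwAt_iff_of_sector jp.inSector jq.inSector ?_ ?_ ⟨hk, hok⟩ (ih o ho)
      · rintro u ⟨hu, hou⟩ huk hul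
        exact Ip.offSector ho hk hl hok hol jp.pos
          (fun e he w hw => (hin p w).not.2 (hFp e he w hw)) hu hou huk hul
      · rintro u ⟨hu, hou⟩ huk hul
        exact Iq.offSector ho hk hl hok hol jq.pos
          (fun e he w hw => (hin q w).not.2 (hFq e he w hw)) hu hou huk hul
    have sx := sector x y z hx hy hz hxy hzx.symm fun r w => Iff.rfl
    have sy := sector y z x hy hz hx hyz hxy.symm fun r w => inside_rotate
    have sz := sector z x y hz hx hy hzx hyz.symm fun r w =>
      inside_rotate.trans inside_rotate
    have mem_nbr : ∀ o u, u ∈ {u ∈ insert v s | G.Adj o u} → u ∈ insert v {u ∈ s | G.Adj o u} := by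
      rintro o u ⟨rfl | hu, hou⟩
      · exact Or.inl rfl
      · exact Or.inr ⟨hu, hou⟩
    rintro o (rfl | ho) k hk l hl m hm
    · have nbr : ∀ u, u ∈ {u ∈ insert o s | G.Adj o u} → u = x ∨ u = y ∨ u = z := by
        rintro u ⟨rfl | hu, hou⟩
        · exact absurd hou (G.loopless.irrefl _)
        · exact (hadj u hu).1 hou
      obtain ⟨⟨a1, a2, a3⟩, a4, a5, a6⟩ := tri p o x y z inp
      obtain ⟨⟨b1, b2, b3⟩, b4, b5, b6⟩ := tri q o x y z inq
      have n1 : ∀ (r : V → Plane) k l, ¬ CCWAt r o k k l := fun r k l => not_isCCW_left _ _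
      have n2 : ∀ (r : V → Plane) k l, ¬ CCWAt r o l k k := fun r k l => not_isCCW_right _ _
      have n3 : ∀ (r : V → Plane) k l, ¬ CCWAt r o k l k := fun r k l => not_isCCW_outer _ _
      rcases nbr k hk with rfl | rfl | rfl <;> rcases nbr l hl with rfl | rfl | rfl <;>
        rcases nbr m hm with rfl | rfl | rfl <;>
        simp only [n1, n2, n3, a1, a2, a3, a4, a5, a6, b1, b2, b3, b4, b5, b6]
    · by_cases hox : o = x
      · subst hox; exact sx k (mem_nbr _ _ hk) l (mem_nbr _ _ hl) m (mem_nbr _ _ hm)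
      by_cases hoy : o = y
      · subst hoy; exact sy k (mem_nbr _ _ hk) l (mem_nbr _ _ hl) m (mem_nbr _ _ hm)
      by_cases hoz : o = z
      · subst hoz; exact sz k (mem_nbr _ _ hk) l (mem_nbr _ _ hl) m (mem_nbr _ _ hm)
      have nbr : ∀ u, u ∈ {u ∈ insert v s | G.Adj o u} → u ∈ {u ∈ s | G.Adj o u} := by
        rintro u ⟨rfl | hu, hou⟩
        · rcases (hadj o ho).1 hou.symm with h | h | h <;> contradiction
        · exact ⟨hu, hou⟩
      exact ih o ho k (nbr k hk) l (nbr l hl) m (nbr m hm)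

end Rotation

/-! ### The outer face is bounded by the root triangle -/

section OuterFace

variable {V : Type*}

@[fun_prop]
lemma continuous_orient {α : Type*} [TopologicalSpace α] {f g h : α → Plane} (hf : Continuous f)
    (hg : Continuous g) (hh : Continuous h) :
    Continuous fun t => orient (f t) (g t) (h t) := by
  simp only [orient_eq]; fun_prop

lemma orient_add_smul (a b x r : Plane) (t : ℝ) :
    orient a b (x + t • r) = orient a b x + t * cross (b - a) r := by
  simp [orient_eq, cross]; ring

lemma cross_rotateLeft (x : Plane) : cross x (rotateLeft x) = x 0 ^ 2 + x 1 ^ 2 := by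
  simp [cross, rotateLeft]; ring

lemma sq_add_sq_pos {x : Plane} (h : x ≠ 0) : 0 < x 0 ^ 2 + x 1 ^ 2 := by
  by_contra hc
  have h0 : x 0 = 0 := by nlinarith [sq_nonneg (x 0), sq_nonneg (x 1)]
  have h1 : x 1 = 0 := by nlinarith [sq_nonneg (x 0), sq_nonneg (x 1)]
  exact h (plane_ext (by simpa using h0) (by simpa using h1))

/-- A point that a line separates from the drawing lies in the outer face. -/
lemma mem_outerFace_of_orient_neg {G : SimpleGraph V} {p : V → Plane} {a b x : Plane}
    (hab : a ≠ b) (hG : ∀ w ∈ drawnSet G p, 0 ≤ orient a b w) (hx : orient a b x < 0) :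
    x ∈ outerFace G p := by
  set H : Set Plane := {w | orient a b w < 0} with hH
  have hHG : H ⊆ (drawnSet G p)ᶜ := fun w hw hw' => (hG w hw').not_gt hw
  have hconv : Convex ℝ H := by
    rw [convex_iff_segment_subset]
    intro y hy z hz w hw
    obtain ⟨t, h0, h1, ht⟩ := mem_segment_iff_coord.1 hw
    simp only [hH, Set.mem_ofPred_eq] at hy hz ⊢
    rw [orient_lineMap_right _ _ _ _ _ t ht]
    rcases h0.eq_or_lt with rfl | h0
    · simpa using hy
    · nlinarith [mul_nonneg (sub_nonneg.2 h1) (neg_pos.2 hy).le, mul_pos h0 (neg_pos.2 hz)]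
  refine ⟨fun h => (hG x h).not_gt hx, fun hb => ?_⟩
  have hsub := hconv.isPreconnected.subset_connectedComponentIn hx hHG
  obtain ⟨M, hM⟩ := (hb.subset hsub).exists_norm_le
  have hba : b - a ≠ 0 := sub_ne_zero.2 hab.symm
  set r := rotateLeft (b - a) with hr
  have hcr : 0 < cross (b - a) r := by rw [hr, cross_rotateLeft]; exact sq_add_sq_pos hba
  have hr0 : 0 < ‖r‖ := by
    rw [norm_pos_iff]; rintro h
    rw [h] at hcr; simp [cross] at hcr
  have hM0 : 0 ≤ M := (norm_nonneg x).trans (hM x hx)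
  -- Moving from `x` away from the line by a vector of norm `M + ‖x‖ + 1` stays in the half-plane
  -- but leaves the ball of radius `M`.
  set t : ℝ := (M + ‖x‖ + 1) / ‖r‖ with ht
  have ht0 : 0 < t := by positivity
  have h1 : x + (-t) • r ∈ H := by
    simp only [hH, Set.mem_ofPred_eq]
    rw [orient_add_smul]
    nlinarith
  have h2 := hM _ h1
  have h3 : ‖(-t) • r‖ = M + ‖x‖ + 1 := by
    rw [norm_smul, norm_neg, Real.norm_of_nonneg ht0.le, ht]; field_simp
  have h4 : ‖(-t) • r‖ ≤ ‖x + (-t) • r‖ + ‖x‖ := by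
    calc ‖(-t) • r‖ = ‖(x + (-t) • r) - x‖ := by congr 1; abel
      _ ≤ _ := norm_sub_le _ _
  linarith

lemma isBounded_inside (a b c : Plane) : Bornology.IsBounded {w | Inside a b c w} := by
  rw [isBounded_iff_forall_norm_le]
  refine ⟨‖a‖ + ‖b‖ + ‖c‖, fun w hw => ?_⟩
  have hD := Inside.pos hw
  have hs := orient_add a b c w
  obtain ⟨h1, h2, h3⟩ := hw
  have e : orient a b c • w = orient w b c • a + orient a w c • b + orient a b w • c := by
    ext i
    simpa using (orient_bary a b c w i).symm
  have : orient a b c * ‖w‖ ≤ orient a b c * (‖a‖ + ‖b‖ + ‖c‖) := by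
    calc orient a b c * ‖w‖ = ‖orient a b c • w‖ := by
          rw [norm_smul, Real.norm_of_nonneg hD.le]
      _ ≤ ‖orient w b c • a‖ + ‖orient a w c • b‖ + ‖orient a b w • c‖ := by
          rw [e]; exact norm_add₃_le
      _ = orient w b c * ‖a‖ + orient a w c * ‖b‖ + orient a b w * ‖c‖ := by
          rw [norm_smul, norm_smul, norm_smul, Real.norm_of_nonneg h1.le,
            Real.norm_of_nonneg h2.le, Real.norm_of_nonneg h3.le]
      _ ≤ orient a b c * ‖a‖ + orient a b c * ‖b‖ + orient a b c * ‖c‖ := by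
          gcongr <;> linarith
      _ = _ := by ring
  exact le_of_mul_le_mul_left this hD

lemma isOpen_inside (a b c : Plane) : IsOpen {w | Inside a b c w} := by
  have h1 : Continuous fun w => orient w b c := by fun_prop
  have h2 : Continuous fun w => orient a w c := by fun_prop
  have h3 : Continuous fun w => orient a b w := by fun_prop
  exact (isOpen_lt continuous_const h1).inter
    ((isOpen_lt continuous_const h2).inter (isOpen_lt continuous_const h3))

/-- A point in a drawn triangle is not in the outer face. -/
lemma notMem_outerFace_of_inside {G : SimpleGraph V} {p : V → Plane} {a b c : V} {x : Plane}
    (hab : G.Adj a b) (hbc : G.Adj b c) (hca : G.Adj c a) (hx : Inside (p a) (p b) (p c) x) :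
    x ∉ outerFace G p := by
  rintro ⟨hxd, hub⟩
  apply hub
  have hD := hx.pos
  set T : Set Plane := {w | Inside (p a) (p b) (p c) w} with hT
  -- The exterior of the closed triangle. The component of `x` misses the boundary, so it is covered
  -- by the disjoint open sets `T` and `U` and remains in the bounded set `T`.
  set U : Set Plane := {w | orient w (p b) (p c) < 0 ∨ orient (p a) w (p c) < 0 ∨
    orient (p a) (p b) w < 0} with hU
  have k1 : Continuous fun w => orient w (p b) (p c) := by fun_prop
  have k2 : Continuous fun w => orient (p a) w (p c) := by fun_prop
  have k3 : Continuous fun w => orient (p a) (p b) w := by fun_prop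
  have hUo : IsOpen U := (isOpen_lt k1 continuous_const).union
    ((isOpen_lt k2 continuous_const).union (isOpen_lt k3 continuous_const))
  refine (isBounded_inside (p a) (p b) (p c)).subset
    (isPreconnected_connectedComponentIn.subset_left_of_subset_union
      (isOpen_inside (p a) (p b) (p c)) hUo ?_ ?_ ⟨x, mem_connectedComponentIn hxd, hx⟩)
  · rw [Set.disjoint_left]
    rintro w ⟨h1, h2, h3⟩ (h | h | h) <;> linarith
  · intro w hw
    have hwd : w ∉ drawnSet G p := connectedComponentIn_subset _ _ hw
    by_contra hc
    simp only [hU, Set.mem_union, Set.mem_ofPred_eq, not_or, not_lt] at hc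
    obtain ⟨hc1, hc2, hc3, hc4⟩ := hc
    have hz : orient w (p b) (p c) = 0 ∨ orient (p a) w (p c) = 0 ∨ orient (p a) (p b) w = 0 := by
      by_contra! hne
      exact hc1 ⟨lt_of_le_of_ne hc2 hne.1.symm, lt_of_le_of_ne hc3 hne.2.1.symm,
        lt_of_le_of_ne hc4 hne.2.2.symm⟩
    apply hwd
    right
    rcases mem_segment_boundary hD hc2 hc3 hc4 hz with h | h | h
    exacts [⟨a, b, hab, h⟩, ⟨b, c, hbc, h⟩, ⟨c, a, hca, h⟩]

lemma eventually_inside_of_midpoint {a b c m r : Plane} (hm : Inside a b c m) :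
    ∀ᶠ ε in nhdsWithin (0 : ℝ) (Set.Ioi 0), Inside a b c (m + ε • r) := by
  have hcont : Continuous fun ε : ℝ => m + ε • r := by fun_prop
  have : ∀ᶠ ε in nhds (0 : ℝ), m + ε • r ∈ {w | Inside a b c w} :=
    hcont.continuousAt.eventually_mem ((isOpen_inside a b c).mem_nhds (by simpa using hm))
  exact this.filter_mono nhdsWithin_le_nhds

lemma midpoint_coord (x y : Plane) (i : Fin 2) :
    midpoint ℝ x y i = (1 - 1 / 2) * x i + 1 / 2 * y i := by
  rw [midpoint_eq_smul_add]
  simp only [PiLp.add_apply, PiLp.smul_apply, smul_eq_mul, invOf_eq_inv]; ring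

lemma eventually_inside_left {a b c : Plane} (h : 0 < orient a b c) :
    ∀ᶠ ε in nhdsWithin (0 : ℝ) (Set.Ioi 0),
      Inside a b c (midpoint ℝ a b + ε • rotateLeft (b - a)) := by
  set m := midpoint ℝ a b with hm
  set r := rotateLeft (b - a) with hr
  have hab : b - a ≠ 0 := by
    intro h0
    rw [sub_eq_zero] at h0
    rw [h0, orient_self_left] at h; exact lt_irrefl _ h
  have hA : Continuous fun ε : ℝ => orient (m + ε • r) b c := by fun_prop
  have hB : Continuous fun ε : ℝ => orient a (m + ε • r) c := by fun_prop
  have mA : 0 < orient (m + (0 : ℝ) • r) b c := by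
    rw [zero_smul, add_zero, orient_lineMap_left _ _ _ _ _ (1 / 2) (midpoint_coord a b),
      orient_self_left]
    linarith
  have mB : 0 < orient a (m + (0 : ℝ) • r) c := by
    rw [zero_smul, add_zero, orient_lineMap_middle _ _ _ _ _ (1 / 2) (midpoint_coord a b),
      orient_self_left]
    linarith
  have eA := (hA.continuousAt.eventually_const_lt mA).filter_mono
    (nhdsWithin_le_nhds (s := Set.Ioi 0))
  have eB := (hB.continuousAt.eventually_const_lt mB).filter_mono
    (nhdsWithin_le_nhds (s := Set.Ioi 0))
  filter_upwards [eA, eB, self_mem_nhdsWithin] with ε h1 h2 h3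
  refine ⟨h1, h2, ?_⟩
  rw [orient_add_smul, orient_lineMap_right _ _ _ _ _ (1 / 2) (midpoint_coord a b),
    orient_self_outer, orient_self_right, hr, cross_rotateLeft]
  have := sq_add_sq_pos hab
  have h3 : 0 < ε := h3
  simp; positivity

/-- The outer darts are the root edges traversed clockwise: the line through a root edge has the
whole drawing on one side. An edge with an inner end has its midpoint in the open root triangle, and
a counterclockwise root edge has that triangle on its left. -/
lemma StackInvariant.isOuterDart_iff {G : SimpleGraph V} {a b c : V} {F : Set (V × V × V)}
    {p : V → Plane} (I : StackInvariant G a b c Set.univ F p) (hab : G.Adj a b)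
    (hbc : G.Adj b c) (hca : G.Adj c a) (u v : V) :
    IsOuterDart G p u v ↔ (u = b ∧ v = a) ∨ (u = c ∧ v = b) ∨ (u = a ∧ v = c) := by
  have hD := I.root_pos
  have vert : ∀ w, 0 ≤ orient (p w) (p b) (p c) ∧ 0 ≤ orient (p a) (p w) (p c) ∧
      0 ≤ orient (p a) (p b) (p w) := by
    intro w
    by_cases h1 : w = a
    · subst h1; simp [orient_self_left, orient_self_outer, hD.le]
    by_cases h2 : w = b
    · subst h2; simp [orient_self_left, orient_self_right, hD.le]
    by_cases h3 : w = c
    · subst h3; simp [orient_self_right, orient_self_outer, hD.le]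
    obtain ⟨k1, k2, k3⟩ := I.inner w trivial h1 h2 h3
    exact ⟨k1.le, k2.le, k3.le⟩
  have drawn : ∀ w ∈ drawnSet G p, 0 ≤ orient w (p b) (p c) ∧ 0 ≤ orient (p a) w (p c) ∧
      0 ≤ orient (p a) (p b) w := by
    rintro w (⟨w, rfl⟩ | ⟨x, y, -, hw⟩)
    · exact vert w
    · obtain ⟨t, h0, h1, ht⟩ := mem_segment_iff_coord.1 hw
      rw [orient_lineMap_right _ _ _ _ _ t ht, orient_lineMap_middle _ _ _ _ _ t ht,
        orient_lineMap_left _ _ _ _ _ t ht]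
      obtain ⟨x1, x2, x3⟩ := vert x
      obtain ⟨y1, y2, y3⟩ := vert y
      have h1 : 0 ≤ 1 - t := by linarith
      exact ⟨by positivity, by positivity, by positivity⟩
  have nbot : (nhdsWithin (0 : ℝ) (Set.Ioi 0)).NeBot := inferInstance
  have refute : ∀ u v, (∀ᶠ ε in nhdsWithin (0 : ℝ) (Set.Ioi 0), Inside (p a) (p b) (p c)
      (midpoint ℝ (p u) (p v) + ε • rotateLeft (p v - p u))) → ¬ IsOuterDart G p u v := by
    rintro u v h ⟨-, h'⟩
    obtain ⟨ε, h1, h2⟩ := (h.and h').exists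
    exact notMem_outerFace_of_inside hab hbc hca h1 h2
  have outer : ∀ x y, G.Adj x y → (∀ w ∈ drawnSet G p, 0 ≤ orient (p x) (p y) w) →
      p x ≠ p y → IsOuterDart G p y x := by
    intro x y hxy hw hne
    refine ⟨hxy.symm, ?_⟩
    filter_upwards [self_mem_nhdsWithin] with ε hε
    refine mem_outerFace_of_orient_neg hne hw ?_
    have hpos := sq_add_sq_pos (sub_ne_zero.2 hne.symm)
    rw [orient_add_smul, orient_lineMap_right _ _ _ _ _ (1 / 2) (midpoint_coord _ _),
      orient_self_outer, orient_self_right,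
      show cross (p y - p x) (rotateLeft (p x - p y)) = -((p y - p x) 0 ^ 2 + (p y - p x) 1 ^ 2) by
        simp [cross, rotateLeft]; ring]
    have hε : 0 < ε := hε
    nlinarith [mul_pos hε hpos]
  constructor
  · intro h
    by_contra hcon
    have huv := h.1
    by_cases hin : Inside (p a) (p b) (p c) (midpoint ℝ (p u) (p v))
    · exact refute u v (eventually_inside_of_midpoint hin) h
    · have huabc : u = a ∨ u = b ∨ u = c := by
        by_contra! hu
        apply hin
        obtain ⟨k1, k2, k3⟩ := I.inner u trivial hu.1 hu.2.1 hu.2.2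
        obtain ⟨l1, l2, l3⟩ := vert v
        refine ⟨?_, ?_, ?_⟩
        · rw [orient_lineMap_left _ _ _ _ _ (1 / 2) (midpoint_coord _ _)]; simp only at *; linarith
        · rw [orient_lineMap_middle _ _ _ _ _ (1 / 2) (midpoint_coord _ _)]
          simp only at *; linarith
        · rw [orient_lineMap_right _ _ _ _ _ (1 / 2) (midpoint_coord _ _)]
          simp only at *; linarith
      have hvabc : v = a ∨ v = b ∨ v = c := by
        by_contra! hv
        apply hin
        obtain ⟨k1, k2, k3⟩ := I.inner v trivial hv.1 hv.2.1 hv.2.2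
        obtain ⟨l1, l2, l3⟩ := vert u
        refine ⟨?_, ?_, ?_⟩
        · rw [orient_lineMap_left _ _ _ _ _ (1 / 2) (midpoint_coord _ _)]; simp only at *; linarith
        · rw [orient_lineMap_middle _ _ _ _ _ (1 / 2) (midpoint_coord _ _)]
          simp only at *; linarith
        · rw [orient_lineMap_right _ _ _ _ _ (1 / 2) (midpoint_coord _ _)]
          simp only at *; linarith
      have D1 : 0 < orient (p b) (p c) (p a) := by rwa [orient_rotate]
      have D2 : 0 < orient (p c) (p a) (p b) := by rwa [orient_rotate (p b), orient_rotate]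
      have r1 := refute a b (eventually_inside_left hD)
      have r2 := refute b c ((eventually_inside_left D1).mono fun _ h => inside_rotate.1 h)
      have r3 := refute c a ((eventually_inside_left D2).mono fun _ h => Inside.rotate h)
      rcases huabc with rfl | rfl | rfl <;> rcases hvabc with rfl | rfl | rfl <;>
        first
        | exact huv.ne rfl
        | exact r1 h
        | exact r2 h
        | exact r3 h
        | (apply hcon; simp)
  · have n1 : p a ≠ p b := fun h => by rw [h, orient_self_left] at hD; exact lt_irrefl _ hD
    have n2 : p b ≠ p c := fun h => by rw [h, orient_self_right] at hD; exact lt_irrefl _ hD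
    have n3 : p c ≠ p a := fun h => by rw [h, orient_self_outer] at hD; exact lt_irrefl _ hD
    rintro (⟨rfl, rfl⟩ | ⟨rfl, rfl⟩ | ⟨rfl, rfl⟩)
    · exact outer _ _ hab (fun w hw => (drawn w hw).2.2) n1
    · exact outer _ _ hbc (fun w hw => by rw [orient_rotate]; exact (drawn w hw).1) n2
    · refine outer _ _ hca (fun w hw => ?_) n3
      rw [orient_rotate w, orient_rotate]; exact (drawn w hw).2.1

theorem Stacked.sameEmbedding {G : SimpleGraph V} {a b c : V} {F : Set (V × V × V)}
    (h : Stacked G a b c Set.univ F) (hab : G.Adj a b) (hbc : G.Adj b c) (hca : G.Adj c a)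
    {p q : V → Plane} (hp : Positive p F) (hq : Positive q F) : SameEmbedding G p q where
  rotation v x y z hx hy hz := h.ccwAt_iff hp hq v trivial x ⟨trivial, hx⟩ y ⟨trivial, hy⟩ z
    ⟨trivial, hz⟩
  outer u v := by
    rw [(h.invariant hp).isOuterDart_iff hab hbc hca, (h.invariant hq).isOuterDart_iff hab hbc hca]

end OuterFace

/-! ### Every planar drawing of a 3-tree is a stacked triangulation -/

lemma inside_of_cone {a b c v w : Plane} (hw : Inside a b c w) (h1 : 0 < orient v a w)
    (h2 : orient v b w < 0) : Inside a b v w := by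
  refine ⟨?_, ?_, hw.2.2⟩
  · simp only [orient_eq] at h2 ⊢; linarith
  · simp only [orient_eq] at h1 ⊢; linarith

lemma mem_segment_of_cone {a b c v w : Plane} (hv : Inside a b c v) (hw : Inside a b c w)
    (h1 : orient v a w = 0) (h2 : orient v b w ≤ 0) : w ∈ segment ℝ v a := by
  have hγ := hv.2.2
  have hw3 := hw.2.2
  have e : ∀ i, orient a b v * (w i - v i) =
      -orient v b w * (a i - v i) + orient v a w * (b i - v i) := by
    intro i; fin_cases i <;> simp only [orient_eq, Fin.zero_eta, Fin.mk_one] <;> ring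
  have hs : orient a b w = orient a b v + orient v b w - orient v a w := by
    simp only [orient_eq]; ring
  refine mem_segment_iff_coord.2 ⟨-orient v b w / orient a b v,
    div_nonneg (by linarith) hγ.le, ?_, fun i => ?_⟩
  · rw [div_le_one hγ]; linarith
  · have := e i
    rw [h1] at this
    field_simp
    linear_combination this

/-- An inner point divides an open triangle into three open triangles and three segments. -/
lemma Inside.split {a b c v w : Plane} (hv : Inside a b c v) (hw : Inside a b c w) :
    (Inside v b c w ∨ Inside a v c w ∨ Inside a b v w) ∨
      w ∈ segment ℝ v a ∨ w ∈ segment ℝ v b ∨ w ∈ segment ℝ v c := by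
  -- The three signed areas at `v` have a vanishing combination with positive weights. Together with
  -- the exclusions from the cones and their boundary rays, this rules out every sign pattern.
  have hsum : orient v b c * orient v a w + orient a v c * orient v b w +
      orient a b v * orient v c w = 0 := by simp only [orient_eq]; ring
  have c1 := inside_of_cone (v := v) hw
  have c2 := inside_of_cone (v := v) hw.rotate
  have c3 := inside_of_cone (v := v) hw.rotate.rotate
  have s1 := mem_segment_of_cone hv hw
  have s2 := mem_segment_of_cone hv.rotate hw.rotate
  have s3 := mem_segment_of_cone hv.rotate.rotate hw.rotate.rotate
  obtain ⟨h1, h2, h3⟩ := hv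
  by_contra! hcon
  obtain ⟨⟨n1, n2, n3⟩, m1, m2, m3⟩ := hcon
  have c1 : 0 < orient v a w → 0 ≤ orient v b w := fun h => by
    by_contra hc; exact n3 (c1 h (not_le.1 hc))
  have c2 : 0 < orient v b w → 0 ≤ orient v c w := fun h => by
    by_contra hc; exact n1 (c2 h (not_le.1 hc)).rotate.rotate
  have c3 : 0 < orient v c w → 0 ≤ orient v a w := fun h => by
    by_contra hc; exact n2 (c3 h (not_le.1 hc)).rotate
  have s1 : orient v a w = 0 → 0 < orient v b w := fun h => by
    by_contra hc; exact m1 (s1 h (not_lt.1 hc))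
  have s2 : orient v b w = 0 → 0 < orient v c w := fun h => by
    by_contra hc; exact m2 (s2 h (not_lt.1 hc))
  have s3 : orient v c w = 0 → 0 < orient v a w := fun h => by
    by_contra hc; exact m3 (s3 h (not_lt.1 hc))
  generalize orient v a w = x at *
  generalize orient v b w = y at *
  generalize orient v c w = z at *
  clear n1 n2 n3 m1 m2 m3 hw
  rcases lt_trichotomy x 0 with hx | hx | hx <;> rcases lt_trichotomy y 0 with hy | hy | hy <;>
    rcases lt_trichotomy z 0 with hz | hz | hz <;>
    first
    | linarith [c1 hx]
    | linarith [c2 hy]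
    | linarith [c3 hz]
    | linarith [s1 hx]
    | linarith [s2 hy]
    | linarith [s3 hz]
    | nlinarith [mul_pos h1 (neg_pos.2 hx), mul_pos h2 (neg_pos.2 hy), mul_pos h3 (neg_pos.2 hz)]
    | (subst_vars; nlinarith [mul_pos h1 hx])
    | (subst_vars; nlinarith [mul_pos h2 hy])

section Planar

variable {V : Type*}

lemma IsPlanarDrawing.disjoint_edges {G : SimpleGraph V} {p : V → Plane}
    (hp : IsPlanarDrawing G p) {u v x y : V} (huv : G.Adj u v) (hxy : G.Adj x y) (h1 : u ≠ x)
    (h2 : u ≠ y) (h3 : v ≠ x) (h4 : v ≠ y) {w : Plane} (hw : w ∈ segment ℝ (p u) (p v))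
    (hw' : w ∈ segment ℝ (p x) (p y)) : False := by
  have hne : s(u, v) ≠ s(x, y) := by
    rw [Ne, Sym2.eq_iff]; tauto
  obtain ⟨k, ⟨hk1, hk2⟩, -⟩ := hp.edge_inter u v x y huv hxy hne ⟨hw, hw'⟩
  simp only [Set.mem_insert_iff, Set.mem_singleton_iff] at hk1 hk2
  grind

lemma IsPlanarDrawing.not_ray {G : SimpleGraph V} {p : V → Plane} (hp : IsPlanarDrawing G p)
    {o u y : V} (hou : G.Adj o u) (hoy : G.Adj o y) (huy : u ≠ y) {t : ℝ} (ht : 0 ≤ t)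
    (h : ∀ i, p u i = (1 - t) * p o i + t * p y i) : False := by
  rcases le_or_gt t 1 with h1 | h1
  · exact hp.vertex_notMem o y u hoy hou.ne' huy (mem_segment_iff_coord.2 ⟨t, ht, h1, h⟩)
  · refine hp.vertex_notMem o u y hou hoy.ne' huy.symm
      (mem_segment_iff_coord.2 ⟨t⁻¹, by positivity, inv_le_one_of_one_le₀ h1.le, fun i => ?_⟩)
    rw [h i]; field_simp; ring

/-- Three mutually adjacent vertices on a line would give two edges leaving one of them in the same
direction. -/
lemma IsPlanarDrawing.orient_ne_zero {G : SimpleGraph V} {p : V → Plane}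
    (hp : IsPlanarDrawing G p) {a b c : V} (hab : G.Adj a b) (hbc : G.Adj b c)
    (hca : G.Adj c a) : orient (p a) (p b) (p c) ≠ 0 := by
  intro h0
  have hd : p b - p a ≠ 0 := sub_ne_zero.2 fun h => hab.ne (hp.injective h).symm
  have hpos := sq_add_sq_pos hd
  set d := p b - p a with hd'
  have d0 : d 0 = p b 0 - p a 0 := rfl
  have d1 : d 1 = p b 1 - p a 1 := rfl
  -- The parameter of the orthogonal projection of `p c` to the line through `p a` and `p b`.
  set t := ((p c 0 - p a 0) * d 0 + (p c 1 - p a 1) * d 1) / (d 0 ^ 2 + d 1 ^ 2) with ht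
  have hc : ∀ i, p c i = (1 - t) * p a i + t * p b i := by
    have key : t * (d 0 ^ 2 + d 1 ^ 2) = (p c 0 - p a 0) * d 0 + (p c 1 - p a 1) * d 1 := by
      rw [ht]; field_simp
    rw [orient_eq, ← d0, ← d1] at h0
    have e0 : t * d 0 = p c 0 - p a 0 := by
      apply mul_right_cancel₀ hpos.ne'
      linear_combination d 0 * key + d 1 * h0
    have e1 : t * d 1 = p c 1 - p a 1 := by
      apply mul_right_cancel₀ hpos.ne'
      linear_combination d 1 * key - d 0 * h0
    rw [d0] at e0
    rw [d1] at e1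
    intro i; fin_cases i
    · simp only [Fin.zero_eta]; linarith
    · simp only [Fin.mk_one]; linarith
  rcases le_or_gt 0 t with h | h
  · exact hp.not_ray hca.symm hab hbc.ne' h hc
  · refine hp.not_ray hbc hab.symm hca.ne (t := 1 - t) (by linarith) fun i => ?_
    rw [hc i]; ring

/-- These signs place `v` across the side `x y` from `z`, within the angle at `z`, so the edges `v
z` and `x y` would cross, at the point of `x y` with weights `A` and `B`. -/
lemma IsPlanarDrawing.not_opposite {G : SimpleGraph V} {p : V → Plane}
    (hp : IsPlanarDrawing G p) {x y z v : V} (hxy : G.Adj x y) (hvz : G.Adj v z)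
    (hxz : x ≠ z) (hyz : y ≠ z) (hxv : x ≠ v) (hyv : y ≠ v)
    (hD : 0 < orient (p x) (p y) (p z))
    (hA : 0 < orient (p v) (p y) (p z)) (hB : 0 < orient (p x) (p v) (p z))
    (hC : orient (p x) (p y) (p v) < 0) : False := by
  have hs := orient_add (p x) (p y) (p z) (p v)
  have hb := orient_bary (p x) (p y) (p z) (p v)
  set A := orient (p v) (p y) (p z)
  set B := orient (p x) (p v) (p z)
  set C := orient (p x) (p y) (p v)
  set D := orient (p x) (p y) (p z)
  set w : Plane := !₂[(A * p x 0 + B * p y 0) / (A + B), (A * p x 1 + B * p y 1) / (A + B)]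
    with hw
  have hwi : ∀ i, w i = (A * p x i + B * p y i) / (A + B) := by
    intro i; fin_cases i <;> simp [hw]
  have hAB : 0 < A + B := by linarith
  have h1 : w ∈ segment ℝ (p x) (p y) := by
    refine mem_segment_iff_coord.2 ⟨B / (A + B), by positivity, ?_, fun i => ?_⟩
    · rw [div_le_one hAB]; linarith
    · rw [hwi]; field_simp; ring
  refine hp.disjoint_edges hxy hvz hxv hxz hyv hyz h1
    (mem_segment_iff_coord.2 ⟨-C / (A + B), div_nonneg (by linarith) hAB.le, ?_, fun i => ?_⟩)
  · rw [div_le_one hAB]; linarith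
  · rw [hwi]; field_simp
    have := hb i
    linear_combination this - p v i * hs

/-- Of four mutually adjacent vertices one is drawn inside the triangle of the others. -/
lemma IsPlanarDrawing.exists_inside {G : SimpleGraph V} {p : V → Plane}
    (hp : IsPlanarDrawing G p) {x y z v : V} (hxy : G.Adj x y) (hyz : G.Adj y z)
    (hzx : G.Adj z x) (hvx : G.Adj v x) (hvy : G.Adj v y) (hvz : G.Adj v z)
    (hD : 0 < orient (p x) (p y) (p z)) (hv : ¬ Inside (p x) (p y) (p z) (p v)) :
    Inside (p v) (p y) (p z) (p x) ∨ Inside (p x) (p v) (p z) (p y) ∨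
      Inside (p x) (p y) (p v) (p z) := by
  have hs := orient_add (p x) (p y) (p z) (p v)
  have nA : orient (p v) (p y) (p z) ≠ 0 := hp.orient_ne_zero hvy hyz hvz.symm
  have nB : orient (p x) (p v) (p z) ≠ 0 := hp.orient_ne_zero hvx.symm hvz hzx
  have nC : orient (p x) (p y) (p v) ≠ 0 := hp.orient_ne_zero hxy hvy.symm hvx
  have o1 := hp.not_opposite hxy hvz hzx.ne' hyz.ne hvx.ne' hvy.ne' hD
  have o2 := hp.not_opposite hyz hvx hxy.ne' hzx.ne hvy.ne' hvz.ne' (by rwa [orient_rotate])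
  have o3 := hp.not_opposite hzx hvy hyz.ne' hxy.ne hvz.ne' hvx.ne'
    (by rwa [orient_rotate (p y), orient_rotate])
  rw [orient_rotate (p x) (p v), orient_rotate (p x) (p y), orient_rotate (p v) (p y)] at o2
  rw [orient_rotate (p y) (p z), orient_rotate (p v) (p y), orient_rotate (p y) (p v),
    orient_rotate (p x) (p y), orient_rotate (p v) (p z), orient_rotate (p x) (p v)] at o3
  have e1 : orient (p v) (p x) (p z) = -orient (p x) (p v) (p z) := orient_swap _ _ _
  have e2 : orient (p v) (p y) (p x) = -orient (p x) (p y) (p v) := by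
    simp only [orient_eq]; ring
  have e3 : orient (p y) (p v) (p z) = -orient (p v) (p y) (p z) := orient_swap _ _ _
  have e4 : orient (p x) (p v) (p y) = -orient (p x) (p y) (p v) := orient_swap_right _ _ _
  have e5 : orient (p z) (p y) (p v) = -orient (p v) (p y) (p z) := by
    simp only [orient_eq]; ring
  have e6 : orient (p x) (p z) (p v) = -orient (p x) (p v) (p z) := orient_swap_right _ _ _
  unfold Inside at hv ⊢
  rw [e1, e2, e3, e4, e5, e6]
  -- Three negative weights contradict their positive sum, two put a corner inside the triangle
  -- formed with `v`, one makes two edges cross, and none puts `v` inside.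
  rcases lt_or_gt_of_ne nA with hA | hA <;> rcases lt_or_gt_of_ne nB with hB | hB <;>
    rcases lt_or_gt_of_ne nC with hC | hC
  · linarith
  · exact Or.inr (Or.inr ⟨by linarith, by linarith, hD⟩)
  · exact Or.inr (Or.inl ⟨by linarith, hD, by linarith⟩)
  · exact (o2 hB hC hA).elim
  · exact Or.inl ⟨hD, by linarith, by linarith⟩
  · exact (o3 hC hA hB).elim
  · exact (o1 hA hB hC).elim
  · exact absurd ⟨hA, hB, hC⟩ hv

/-- `BuiltFrom G T s`: the subgraph induced by `s` arises from the one induced by `T` by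
repeatedly adding a vertex adjacent to exactly the vertices of a triangle. -/
inductive BuiltFrom (G : SimpleGraph V) (T : Set V) : Set V → Prop
  | base : BuiltFrom G T T
  | step (s : Set V) (v x y z : V) (h : BuiltFrom G T s) (hv : v ∉ s) (hx : x ∈ s) (hy : y ∈ s)
      (hz : z ∈ s) (hxy : G.Adj x y) (hyz : G.Adj y z) (hzx : G.Adj z x)
      (hadj : ∀ u ∈ s, G.Adj v u ↔ u = x ∨ u = y ∨ u = z) : BuiltFrom G T (insert v s)

lemma BuiltFrom.root_subset {G : SimpleGraph V} {T s : Set V} (h : BuiltFrom G T s) : T ⊆ s := by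
  induction h with
  | base => exact subset_rfl
  | step s v x y z h hv hx hy hz hxy hyz hzx hadj ih => exact ih.trans (Set.subset_insert _ _)

/-- Since `v` is adjacent only to the root triangle, it can be added first; the resulting complete
graph on four vertices can equally be grown from `v x y`. -/
lemma BuiltFrom.swap_root {G : SimpleGraph V} {v x y z : V} {s : Set V}
    (hxy : G.Adj x y) (hyz : G.Adj y z) (hzx : G.Adj z x)
    (h : BuiltFrom G {x, y, z} s) (hv : v ∉ s)
    (hadj : ∀ u ∈ s, G.Adj v u ↔ u = x ∨ u = y ∨ u = z) :
    BuiltFrom G {v, x, y} (insert v s) := by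
  induction h with
  | base =>
    have e : insert v ({x, y, z} : Set V) = insert z {v, x, y} := by
      ext u; simp only [Set.mem_insert_iff, Set.mem_singleton_iff]; tauto
    have hvx : G.Adj v x := (hadj x (by simp)).2 (by simp)
    have hvy : G.Adj v y := (hadj y (by simp)).2 (by simp)
    have hvz : G.Adj v z := (hadj z (by simp)).2 (by simp)
    rw [e]
    refine BuiltFrom.step _ z v x y .base ?_ (by simp) (by simp) (by simp) hvx hxy hvy.symm ?_
    · simp [hvz.ne', hzx.ne, hyz.ne']
    · rintro u (rfl | rfl | rfl)
      · simp [hvz.symm]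
      · simp [hzx]
      · simp [hyz.symm]
  | step s u k l m h hu hk hl hm hkl hlm hmk hadj' ih =>
    have hsub := h.root_subset
    have hv' : v ∉ s := fun h => hv (Or.inr h)
    have hvu : v ≠ u := fun h => hv (Or.inl h)
    have := ih hv' fun w hw => hadj w (Or.inr hw)
    rw [Set.insert_comm v u s]
    refine BuiltFrom.step _ u k l m this ?_ (Or.inr hk) (Or.inr hl) (Or.inr hm) hkl hlm hmk ?_
    · rintro (h | h)
      · exact hvu h.symm
      · exact hu h
    · rintro w (rfl | hw)
      · have h1 : ¬ G.Adj u w := by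
          intro h
          rcases (hadj u (Or.inl rfl)).1 h.symm with rfl | rfl | rfl
          all_goals exact hu (hsub (by simp))
        have h2 : ¬ (w = k ∨ w = l ∨ w = m) := by
          rintro (rfl | rfl | rfl) <;> contradiction
        exact iff_of_false h1 h2
      · exact hadj' w hw

/-- A 3-tree can be built from each of its triangles. -/
lemma BuiltFrom.reroot {G : SimpleGraph V} {a b c : V} {s : Set V}
    (h : BuiltFrom G {a, b, c} s) : ∀ x ∈ s, ∀ y ∈ s, ∀ z ∈ s, G.Adj x y → G.Adj y z →
      G.Adj z x → BuiltFrom G {x, y, z} s := by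
  induction h with
  | base =>
    intro x hx y hy z hz hxy hyz hzx
    have e : ({x, y, z} : Set V) = {a, b, c} := by
      have := hxy.ne; have := hyz.ne; have := hzx.ne
      ext u
      simp only [Set.mem_insert_iff, Set.mem_singleton_iff] at hx hy hz ⊢
      grind
    rw [← e]; exact .base
  | step s v k l m h hv hk hl hm hkl hlm hmk hadj ih =>
    -- A triangle at the last vertex `v` has its other corners among `k, l, m`. Rerooting the rest
    -- at `k l m` and applying `swap_root` moves `v` into the root.
    have key : ∀ y ∈ s, ∀ z ∈ s, G.Adj v y → G.Adj v z → y ≠ z →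
        BuiltFrom G {v, y, z} (insert v s) := by
      intro y hy z hz hvy hvz hyz
      have aux : ∀ w ∈ s, G.Adj y z → G.Adj z w → G.Adj w y →
          (∀ u, (u = k ∨ u = l ∨ u = m) ↔ (u = y ∨ u = z ∨ u = w)) →
          BuiltFrom G {v, y, z} (insert v s) := by
        intro w hw h1 h2 h3 h4
        exact (ih y hy z hz w hw h1 h2 h3).swap_root h1 h2 h3 hv
          fun u hu => (hadj u hu).trans (h4 u)
      rcases (hadj y hy).1 hvy with rfl | rfl | rfl <;> rcases (hadj z hz).1 hvz with rfl | rfl | rfl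
      · exact absurd rfl hyz
      · exact aux m hm hkl hlm hmk fun u => by tauto
      · exact aux l hl hmk.symm hlm.symm hkl.symm fun u => by tauto
      · exact aux m hm hkl.symm hmk.symm hlm.symm fun u => by tauto
      · exact absurd rfl hyz
      · exact aux k hk hlm hmk hkl fun u => by tauto
      · exact aux l hl hmk hkl hlm fun u => by tauto
      · exact aux k hk hlm.symm hkl.symm hmk.symm fun u => by tauto
      · exact absurd rfl hyz
    rintro x (rfl | hx) y (rfl | hy) z (rfl | hz) hxy hyz hzx
    · exact absurd rfl hxy.ne
    · exact absurd rfl hxy.ne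
    · exact absurd rfl hzx.ne
    · exact key y hy z hz hxy hzx.symm hyz.ne
    · exact absurd rfl hyz.ne
    · rw [Set.insert_comm]; exact key x hx z hz hxy.symm hyz hzx.ne'
    · have e : ({x, y, z} : Set V) = {z, x, y} := by
        ext u; simp only [Set.mem_insert_iff, Set.mem_singleton_iff]; tauto
      rw [e]; exact key x hx y hy hzx hyz.symm hxy.ne
    · exact .step s v k l m (ih x hx y hy z hz hxy hyz hzx) hv hk hl hm hkl hlm hmk hadj

lemma IsKTreeOn.exists_builtFrom {G : SimpleGraph V} {s : Finset V} (h : IsKTreeOn G 3 s) :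
    ∃ a b c, G.Adj a b ∧ G.Adj b c ∧ G.Adj c a ∧ BuiltFrom G {a, b, c} (s : Set V) := by
  classical
  induction h with
  | base s hs =>
    obtain ⟨d, hd⟩ : s.Nonempty := by
      rw [← Finset.card_pos, hs.card_eq]; norm_num
    have h3 : G.IsNClique 3 (s.erase d) := by
      refine ⟨hs.isClique.subset (by simp), ?_⟩
      rw [Finset.card_erase_of_mem hd, hs.card_eq]
    obtain ⟨a, b, c, hab, hac, hbc, he⟩ := SimpleGraph.is3Clique_iff.1 h3
    have hmem : ∀ u, u ∈ s.erase d ↔ u = a ∨ u = b ∨ u = c := by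
      intro u; rw [he]; simp
    have hadj : ∀ u, (u = a ∨ u = b ∨ u = c) → G.Adj d u := by
      intro u hu
      have := (hmem u).2 hu
      rw [Finset.mem_erase] at this
      exact hs.isClique hd this.2 this.1.symm
    have e : (s : Set V) = insert d {a, b, c} := by
      rw [← Finset.insert_erase hd, he]; simp
    refine ⟨a, b, c, hab, hbc, hac.symm, ?_⟩
    rw [e]
    refine .step _ d a b c .base ?_ (by simp) (by simp) (by simp) hab hbc hac.symm ?_
    · intro h
      exact (hadj d h).ne rfl
    · intro u hu
      exact iff_of_true (hadj u hu) hu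
  | step s K v hv h hK hclique hadj ih =>
    obtain ⟨a, b, c, hab, hbc, hca, hb⟩ := ih
    obtain ⟨x, y, z, hxy, hxz, hyz, rfl⟩ := SimpleGraph.is3Clique_iff.1 hclique
    refine ⟨a, b, c, hab, hbc, hca, ?_⟩
    rw [Finset.coe_cons]
    refine .step _ v x y z hb (by simpa using hv) (hK (by simp)) (hK (by simp)) (hK (by simp))
      hxy hyz hxz.symm fun u hu => ?_
    rw [hadj u hu]; simp

/-- The outer face of a drawing of a 3-tree is bounded by a triangle. -/
lemma BuiltFrom.exists_outer {G : SimpleGraph V} {p : V → Plane} (hp : IsPlanarDrawing G p)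
    {a b c : V} {s : Set V} (hab : G.Adj a b) (hbc : G.Adj b c) (hca : G.Adj c a)
    (h : BuiltFrom G {a, b, c} s) :
    ∃ x ∈ s, ∃ y ∈ s, ∃ z ∈ s, G.Adj x y ∧ G.Adj y z ∧ G.Adj z x ∧
      0 < orient (p x) (p y) (p z) ∧
      ∀ w ∈ s, w ≠ x → w ≠ y → w ≠ z → Inside (p x) (p y) (p z) (p w) := by
  induction h with
  | base =>
    rcases lt_or_gt_of_ne (hp.orient_ne_zero hab hbc hca) with h | h
    · refine ⟨b, by simp, a, by simp, c, by simp, hab.symm, hca.symm, hbc.symm, ?_, ?_⟩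
      · rw [orient_swap]; linarith
      · rintro w (rfl | rfl | rfl) h1 h2 h3 <;> contradiction
    · refine ⟨a, by simp, b, by simp, c, by simp, hab, hbc, hca, h, ?_⟩
      rintro w (rfl | rfl | rfl) h1 h2 h3 <;> contradiction
  | step s v k l m h hv hk hl hm hkl hlm hmk hadj ih =>
    obtain ⟨x, hx, y, hy, z, hz, hxy, hyz, hzx, hD, hin⟩ := ih
    have hvx' : v ≠ x := fun h => hv (h ▸ hx)
    have hvy' : v ≠ y := fun h => hv (h ▸ hy)
    have hvz' : v ≠ z := fun h => hv (h ▸ hz)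
    by_cases hvin : Inside (p x) (p y) (p z) (p v)
    · refine ⟨x, Or.inr hx, y, Or.inr hy, z, Or.inr hz, hxy, hyz, hzx, hD, ?_⟩
      rintro w (rfl | hw) h1 h2 h3
      · exact hvin
      · exact hin w hw h1 h2 h3
    -- An edge from an outside `v` to an inner vertex would cross the outer triangle. Hence `v` is
    -- attached to the corners of that triangle, and one of them is enclosed by `v` and the other
    -- two.
    · have claim : ∀ u ∈ s, G.Adj v u → u = x ∨ u = y ∨ u = z := by
        intro u hu hvu
        by_contra! hc
        obtain ⟨w, hw, hw'⟩ := exists_mem_segment_boundary (hin u hu hc.1 hc.2.1 hc.2.2) hvin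
        rcases hw' with hw' | hw' | hw'
        · exact hp.disjoint_edges hvu.symm hxy hc.1 hc.2.1 hvx' hvy' hw hw'
        · exact hp.disjoint_edges hvu.symm hyz hc.2.1 hc.2.2 hvy' hvz' hw hw'
        · exact hp.disjoint_edges hvu.symm hzx hc.2.2 hc.1 hvz' hvx' hw hw'
      have hvk := claim k hk ((hadj k hk).2 (by simp))
      have hvl := claim l hl ((hadj l hl).2 (by simp))
      have hvm := claim m hm ((hadj m hm).2 (by simp))
      have n1 := hkl.ne
      have n2 := hlm.ne
      have n3 := hmk.ne
      have hvx : G.Adj v x := (hadj x hx).2 (by grind)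
      have hvy : G.Adj v y := (hadj y hy).2 (by grind)
      have hvz : G.Adj v z := (hadj z hz).2 (by grind)
      rcases hp.exists_inside hxy hyz hzx hvx hvy hvz hD hvin with h | h | h
      · refine ⟨v, Or.inl rfl, y, Or.inr hy, z, Or.inr hz, hvy, hyz, hvz.symm, h.pos, ?_⟩
        rintro w (rfl | hw) h1 h2 h3
        · contradiction
        · by_cases hwx : w = x
          · exact hwx ▸ h
          · exact h.trans_left (hin w hw hwx h2 h3)
      · refine ⟨x, Or.inr hx, v, Or.inl rfl, z, Or.inr hz, hvx.symm, hvz, hzx, h.pos, ?_⟩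
        rintro w (rfl | hw) h1 h2 h3
        · contradiction
        · by_cases hwy : w = y
          · exact hwy ▸ h
          · exact h.trans_middle (hin w hw h1 hwy h3)
      · refine ⟨x, Or.inr hx, y, Or.inr hy, v, Or.inl rfl, hxy, hvy.symm, hvx, h.pos, ?_⟩
        rintro w (rfl | hw) h1 h2 h3
        · contradiction
        · by_cases hwz : w = z
          · exact hwz ▸ h
          · exact h.trans_right (hin w hw h1 h2 hwz)

/-- Edges cannot leave a face, so the next vertex is attached to the corners of the face containing
it. The induction also records that vertices still to come lie in open faces; `Inside.split` and
planarity preserve this. -/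
lemma BuiltFrom.exists_stacked {G : SimpleGraph V} {p : V → Plane} (hp : IsPlanarDrawing G p)
    {x y z : V} {s : Set V} (hxy : G.Adj x y) (hyz : G.Adj y z) (hzx : G.Adj z x)
    (hD : 0 < orient (p x) (p y) (p z))
    (hin : ∀ w, w ≠ x → w ≠ y → w ≠ z → Inside (p x) (p y) (p z) (p w))
    (h : BuiltFrom G {x, y, z} s) :
    ∃ F, Stacked G x y z s F ∧ Positive p F ∧ ∀ w ∉ s, ∃ f ∈ F, p w ∈ openTriangle p f := by
  induction h with
  | base =>
    refine ⟨_, .base hxy hyz hzx, ?_, ?_⟩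
    · rintro f rfl; exact hD
    · intro w hw
      simp only [Set.mem_insert_iff, Set.mem_singleton_iff, not_or] at hw
      exact ⟨_, rfl, hin w hw.1 hw.2.1 hw.2.2⟩
  | step s v k l m h hv hk hl hm hkl hlm hmk hadj ih =>
    obtain ⟨F, hF, hpos, hout⟩ := ih
    have I := hF.invariant hpos
    obtain ⟨⟨a, b, c⟩, hf, hvf⟩ := hout v hv
    obtain ⟨ha, hb, hc⟩ := I.face_mem a b c hf
    obtain ⟨hab, hbc, hca⟩ := I.face_adj a b c hf
    have hva : v ≠ a := fun h => hv (h ▸ ha)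
    have hvb : v ≠ b := fun h => hv (h ▸ hb)
    have hvc : v ≠ c := fun h => hv (h ▸ hc)
    have claim : ∀ u ∈ s, G.Adj v u → u = a ∨ u = b ∨ u = c := by
      intro u hu hvu
      by_contra! hne
      have hnot : ¬ Inside (p a) (p b) (p c) (p u) := fun hi =>
        Set.disjoint_left.1 (I.cell_face {u} ⟨u, hu, u, hu, Or.inl rfl, by simp⟩ _ hf)
          (by rw [convexHull_image_single]; rfl) hi
      obtain ⟨w, hw, hw'⟩ := exists_mem_segment_boundary hvf hnot
      rcases hw' with hw' | hw' | hw'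
      · exact hp.disjoint_edges hvu hab hva hvb hne.1 hne.2.1 hw hw'
      · exact hp.disjoint_edges hvu hbc hvb hvc hne.2.1 hne.2.2 hw hw'
      · exact hp.disjoint_edges hvu hca hvc hva hne.2.2 hne.1 hw hw'
    have hvk := claim k hk ((hadj k hk).2 (by simp))
    have hvl := claim l hl ((hadj l hl).2 (by simp))
    have hvm := claim m hm ((hadj m hm).2 (by simp))
    have n1 := hkl.ne
    have n2 := hlm.ne
    have n3 := hmk.ne
    have heq : ∀ u, (u = k ∨ u = l ∨ u = m) ↔ (u = a ∨ u = b ∨ u = c) := by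
      intro u; grind
    have hva' : G.Adj v a := (hadj a ha).2 ((heq a).2 (by simp))
    have hvb' : G.Adj v b := (hadj b hb).2 ((heq b).2 (by simp))
    have hvc' : G.Adj v c := (hadj c hc).2 ((heq c).2 (by simp))
    refine ⟨_, .step s F a b c v hF hf hv fun u hu => (hadj u hu).trans (heq u),
      positive_subdivide.2 ⟨fun f hf => hpos f hf.1, hvf⟩, ?_⟩
    intro w hw
    simp only [Set.mem_insert_iff, not_or] at hw
    obtain ⟨f, hf', hwf⟩ := hout w hw.2
    by_cases hfe : f = (a, b, c)
    · subst hfe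
      have hwa : w ≠ a := fun h => hw.2 (h ▸ ha)
      have hwb : w ≠ b := fun h => hw.2 (h ▸ hb)
      have hwc : w ≠ c := fun h => hw.2 (h ▸ hc)
      rcases Inside.split hvf hwf with (h | h | h) | h | h | h
      · exact ⟨(v, b, c), Or.inr (by simp), h⟩
      · exact ⟨(a, v, c), Or.inr (by simp), h⟩
      · exact ⟨(a, b, v), Or.inr (by simp), h⟩
      · exact absurd h (hp.vertex_notMem v a w hva' hw.1 hwa)
      · exact absurd h (hp.vertex_notMem v b w hvb' hw.1 hwb)
      · exact absurd h (hp.vertex_notMem v c w hvc' hw.1 hwc)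
    · exact ⟨f, Or.inl ⟨hf', hfe⟩, hwf⟩

theorem PlaneGraph.IsPlane3Tree.exists_stacked [Fintype V] {G : PlaneGraph V}
    (hG : G.IsPlane3Tree) {p : V → Plane} (hp : IsPlanarDrawing G.graph p) :
    ∃ a b c F, G.graph.Adj a b ∧ G.graph.Adj b c ∧ G.graph.Adj c a ∧
      Stacked G.graph a b c Set.univ F ∧ Positive p F := by
  obtain ⟨a, b, c, hab, hbc, hca, h⟩ : ∃ a b c, G.graph.Adj a b ∧ G.graph.Adj b c ∧
      G.graph.Adj c a ∧ BuiltFrom G.graph {a, b, c} (Set.univ : Set V) := by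
    classical
    rcases hG with h | h
    · simpa using h.exists_builtFrom
    · obtain ⟨a, b, c, hab, hac, hbc, he⟩ := SimpleGraph.is3Clique_iff.1 h
      refine ⟨a, b, c, hab, hbc, hac.symm, ?_⟩
      rw [← Finset.coe_univ, he]
      simpa using BuiltFrom.base
  obtain ⟨x, -, y, -, z, -, hxy, hyz, hzx, hD, hin⟩ := h.exists_outer hp hab hbc hca
  obtain ⟨F, hF, hpos, -⟩ := BuiltFrom.exists_stacked hp hxy hyz hzx hD (fun w => hin w trivial)
    (h.reroot x trivial y trivial z trivial hxy hyz hzx)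
  exact ⟨x, y, z, F, hxy, hyz, hzx, hF, hpos⟩

end Planar

/-! ### Orientation of triangles and the order of crossings on the axis -/

/-- The abscissa of the point where the line through `x` and `y` meets the horizontal axis. -/
noncomputable def crossing (x y : Plane) : ℝ := (y 1 * x 0 - x 1 * y 0) / (y 1 - x 1)

lemma crossing_comm (x y : Plane) : crossing x y = crossing y x := by
  unfold crossing
  rw [← neg_div_neg_eq]
  congr 1 <;> ring

lemma crossing_of_left {x y : Plane} (hx : x 1 = 0) (hy : y 1 ≠ 0) : crossing x y = x 0 := by
  unfold crossing
  rw [hx]; field_simp; ring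

lemma crossing_of_right {x y : Plane} (hy : y 1 = 0) (hx : x 1 ≠ 0) : crossing x y = y 0 := by
  rw [crossing_comm, crossing_of_left hy hx]

lemma sub_ne_zero_of_mul_nonpos {x y : ℝ} (hx : x ≠ 0) (h : x * y ≤ 0) : x - y ≠ 0 := by
  intro h0
  have : y = x := by linarith
  rw [this] at h
  exact hx (mul_self_eq_zero.1 (le_antisymm h (mul_self_nonneg x)))

/-- A triangle with one corner across the axis from the others is positively oriented if and only
if its sides at that corner meet the axis in the right order. -/
lemma orient_pos_iff_crossing {u w z : Plane} (hu : u 1 ≠ 0) (hw : u 1 * w 1 ≤ 0)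
    (hz : u 1 * z 1 ≤ 0) :
    0 < orient u w z ↔ 0 < u 1 * (crossing u z - crossing u w) := by
  have h1 := sub_ne_zero_of_mul_nonpos hu hw
  have h2 := sub_ne_zero_of_mul_nonpos hu hz
  have hu2 : 0 < u 1 * u 1 := mul_self_pos.2 hu
  have p1 : 0 < (u 1 - w 1) * u 1 := by nlinarith
  have p2 : 0 < (u 1 - z 1) * u 1 := by nlinarith
  have e : orient u w z * (u 1 * u 1) * (u 1 * u 1) =
      ((u 1 - w 1) * u 1) * ((u 1 - z 1) * u 1) * (u 1 * (crossing u z - crossing u w)) := by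
    have h1' : w 1 - u 1 ≠ 0 := by intro h; apply h1; linarith
    have h2' : z 1 - u 1 ≠ 0 := by intro h; apply h2; linarith
    unfold crossing
    rw [orient_eq]
    field_simp
    ring
  constructor
  · intro h
    have : 0 < ((u 1 - w 1) * u 1) * ((u 1 - z 1) * u 1) *
        (u 1 * (crossing u z - crossing u w)) := by rw [← e]; positivity
    exact (pos_iff_pos_of_mul_pos this).1 (by positivity)
  · intro h
    have : 0 < orient u w z * (u 1 * u 1) * (u 1 * u 1) := by rw [e]; positivity
    have := (pos_iff_pos_of_mul_pos this).2 hu2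
    exact (pos_iff_pos_of_mul_pos this).2 hu2

lemma sign_eq_iff_pos {x y : ℝ} (h : SignType.sign x = SignType.sign y) : 0 < x ↔ 0 < y := by
  rw [← sign_eq_one_iff, ← sign_eq_one_iff, h]

lemma sign_eq_iff_neg {x y : ℝ} (h : SignType.sign x = SignType.sign y) : x < 0 ↔ y < 0 := by
  rw [← sign_eq_neg_one_iff, ← sign_eq_neg_one_iff, h]

lemma sign_eq_iff_zero {x y : ℝ} (h : SignType.sign x = SignType.sign y) : x = 0 ↔ y = 0 := by
  rw [← sign_eq_zero_iff (a := x), h, sign_eq_zero_iff]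

lemma sign_eq_iff_nonpos {x y : ℝ} (h : SignType.sign x = SignType.sign y) : x ≤ 0 ↔ y ≤ 0 := by
  rw [← not_lt, ← not_lt, sign_eq_iff_pos h]

/-- `u'` is on the same side of the horizontal axis as `u`; points on the axis are moved by `f`. -/
structure PointRel (f : ℝ → ℝ) (u u' : Plane) : Prop where
  sign : SignType.sign (u' 1) = SignType.sign (u 1)
  axis : u 1 = 0 → u' 0 = f (u 0)

/-- If the segment from `u` to `w` meets the horizontal axis in one point, then the segment from
`u'` to `w'` does so in the image of this point under `f`. -/
def CrossRel (f : ℝ → ℝ) (u u' w w' : Plane) : Prop :=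
  u 1 * w 1 ≤ 0 → (u 1 ≠ 0 ∨ w 1 ≠ 0) → crossing u' w' = f (crossing u w)

lemma CrossRel.symm {f : ℝ → ℝ} {u u' w w' : Plane} (h : CrossRel f u u' w w') :
    CrossRel f w w' u u' := fun h1 h2 => by
  rw [crossing_comm w' u', crossing_comm w u]
  exact h (by rwa [mul_comm]) h2.symm

lemma PointRel.crossRel_left {f : ℝ → ℝ} {u u' w w' : Plane} (hu : PointRel f u u')
    (hw : PointRel f w w') (h : u 1 = 0) : CrossRel f u u' w w' := by
  intro _ h2
  have hw1 : w 1 ≠ 0 := h2.resolve_left (fun k => k h)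
  rw [crossing_of_left h hw1, crossing_of_left ((sign_eq_iff_zero hu.sign).2 h)
    ((sign_eq_iff_zero hw.sign).not.2 hw1), hu.axis h]

lemma PointRel.crossRel_right {f : ℝ → ℝ} {u u' w w' : Plane} (hu : PointRel f u u')
    (hw : PointRel f w w') (h : w 1 = 0) : CrossRel f u u' w w' :=
  (hw.crossRel_left hu h).symm

lemma crossRel_of_mul_pos {f : ℝ → ℝ} {u u' w w' : Plane} (h : 0 < u 1 * w 1) :
    CrossRel f u u' w w' := fun h' => absurd h' (not_le.2 h)

lemma PointRel.mul_nonpos {f : ℝ → ℝ} {u u' w w' : Plane} (hu : PointRel f u u')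
    (hw : PointRel f w w') (h : u 1 * w 1 ≤ 0) : u' 1 * w' 1 ≤ 0 := by
  refine (sign_eq_iff_nonpos ?_).2 h
  rw [sign_mul, sign_mul, hu.sign, hw.sign]

lemma orient_pos_of_apex {f : ℝ → ℝ} (hf : StrictMono f) {u u' w w' z z' : Plane}
    (hu : PointRel f u u') (hw : PointRel f w w') (hz : PointRel f z z')
    (huw : CrossRel f u u' w w') (huz : CrossRel f u u' z z') (h : u 1 ≠ 0)
    (h1 : u 1 * w 1 ≤ 0) (h2 : u 1 * z 1 ≤ 0) (ho : 0 < orient u w z) :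
    0 < orient u' w' z' := by
  have h' : u' 1 ≠ 0 := (sign_eq_iff_zero hu.sign).not.2 h
  rw [orient_pos_iff_crossing h' (hu.mul_nonpos hw h1) (hu.mul_nonpos hz h2),
    huw h1 (Or.inl h), huz h2 (Or.inl h)]
  rw [orient_pos_iff_crossing h h1 h2] at ho
  rcases lt_or_gt_of_ne h with hn | hn
  · have : u' 1 < 0 := (sign_eq_iff_neg hu.sign).2 hn
    have := hf (show crossing u z < crossing u w by nlinarith)
    nlinarith
  · have : 0 < u' 1 := (sign_eq_iff_pos hu.sign).2 hn
    have := hf (show crossing u w < crossing u z by nlinarith)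
    nlinarith

/-- One of `w` and `z` lies off the axis, and neither other corner is strictly on its side; it
serves as the apex. -/
lemma orient_pos_of_axis {f : ℝ → ℝ} (hf : StrictMono f) {u u' w w' z z' : Plane}
    (hu : PointRel f u u') (hw : PointRel f w w') (hz : PointRel f z z')
    (hwz : CrossRel f w w' z z') (h : u 1 = 0) (h1 : w 1 * z 1 ≤ 0) (ho : 0 < orient u w z) :
    0 < orient u' w' z' := by
  have huw := hu.crossRel_left hw h
  have huz := hu.crossRel_left hz h
  by_cases hw1 : w 1 = 0
  · have hz1 : z 1 ≠ 0 := by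
      intro hz1
      rw [orient_eq, h, hw1, hz1] at ho
      simp at ho
    rw [← orient_rotate, ← orient_rotate]
    refine orient_pos_of_apex hf hz hu hw huz.symm hwz.symm hz1 (by rw [h]; simp)
      (by rw [hw1]; simp) ?_
    rwa [orient_rotate w, orient_rotate]
  · rw [← orient_rotate]
    refine orient_pos_of_apex hf hw hz hu hwz huw.symm hw1 h1 (by rw [h]; simp) ?_
    rwa [orient_rotate]

/-! ### Inserting a vertex with prescribed crossings -/

/-- The inner point `v` of `a b c` has a counterpart in `a' b' c'`. -/
def HasInsert (f : ℝ → ℝ) (a b c v a' b' c' : Plane) : Prop :=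
  ∃ v', Inside a' b' c' v' ∧ PointRel f v v' ∧ CrossRel f v v' a a' ∧ CrossRel f v v' b b' ∧
    CrossRel f v v' c c'

lemma HasInsert.rotate {f : ℝ → ℝ} {a b c v a' b' c' : Plane}
    (h : HasInsert f b c a v b' c' a') : HasInsert f a b c v a' b' c' := by
  obtain ⟨v', h1, h2, h3, h4, h5⟩ := h
  exact ⟨v', inside_rotate.1 h1, h2, h5, h3, h4⟩

/-- Intended for `v` on the axis: capital letters are its barycentric weights, small letters the
heights of the corners. If the side opposite the first corner misses the axis, then the first corner
lies across it; the other two weights are positive by hypothesis, and the balance of heights forces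
the first. -/
lemma pos_of_balanced {A B C A' B' C' x y z x' y' z' : ℝ} (hA : 0 < A) (hB : 0 < B) (hC : 0 < C)
    (hs : A * x + B * y + C * z = 0) (hs' : A' * x' + B' * y' + C' * z' = 0)
    (hx : SignType.sign x' = SignType.sign x) (hy : SignType.sign y' = SignType.sign y)
    (hz : SignType.sign z' = SignType.sign z) (h1 : y * z ≤ 0 → 0 < A')
    (h2 : z * x ≤ 0 → 0 < B') (h3 : x * y ≤ 0 → 0 < C') : 0 < A' := by
  by_cases k : y * z ≤ 0
  · exact h1 k
  rcases mul_pos_iff.1 (not_le.1 k) with ⟨hy0, hz0⟩ | ⟨hy0, hz0⟩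
  · have hx0 : x < 0 := by
      by_contra hx
      have := mul_nonneg hA.le (not_lt.1 hx)
      have := mul_pos hB hy0
      have := mul_pos hC hz0
      linarith
    have := mul_pos (h2 (mul_neg_of_pos_of_neg hz0 hx0).le) ((sign_eq_iff_pos hy).2 hy0)
    have := mul_pos (h3 (mul_neg_of_neg_of_pos hx0 hy0).le) ((sign_eq_iff_pos hz).2 hz0)
    by_contra hA'
    have := mul_nonneg_of_nonpos_of_nonpos (not_lt.1 hA') ((sign_eq_iff_neg hx).2 hx0).le
    linarith
  · have hx0 : 0 < x := by
      by_contra hx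
      have := mul_nonpos_of_nonneg_of_nonpos hA.le (not_lt.1 hx)
      have := mul_neg_of_pos_of_neg hB hy0
      have := mul_neg_of_pos_of_neg hC hz0
      linarith
    have := mul_neg_of_pos_of_neg (h2 (mul_neg_of_neg_of_pos hz0 hx0).le)
      ((sign_eq_iff_neg hy).2 hy0)
    have := mul_neg_of_pos_of_neg (h3 (mul_neg_of_pos_of_neg hx0 hy0).le)
      ((sign_eq_iff_neg hz).2 hz0)
    by_contra hA'
    have := mul_nonpos_of_nonpos_of_nonneg (not_lt.1 hA') ((sign_eq_iff_pos hx).2 hx0).le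
    linarith

section Insert

variable {f : ℝ → ℝ} {a b c v a' b' c' : Plane}

lemma hasInsert_axis (hf : StrictMono f) (hv : Inside a b c v)
    (ha : PointRel f a a') (hb : PointRel f b b') (hc : PointRel f c c')
    (hab : CrossRel f a a' b b') (hbc : CrossRel f b b' c c') (hca : CrossRel f c c' a a')
    (h : v 1 = 0) : HasInsert f a b c v a' b' c' := by
  set v' : Plane := !₂[f (v 0), 0] with hv'
  have v0 : v' 0 = f (v 0) := rfl
  have v1 : v' 1 = 0 := rfl
  have hvr : PointRel f v v' := ⟨by rw [v1, h], fun _ => v0⟩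
  refine ⟨v', ?_, hvr, hvr.crossRel_left ha h, hvr.crossRel_left hb h, hvr.crossRel_left hc h⟩
  have hs := orient_bary a' b' c' v' 1
  rw [v1, mul_zero] at hs
  obtain ⟨h1, h2, h3⟩ := hv
  have k1 : b 1 * c 1 ≤ 0 → 0 < orient v' b' c' := fun k =>
    orient_pos_of_axis hf hvr hb hc hbc h k h1
  have k2 : c 1 * a 1 ≤ 0 → 0 < orient a' v' c' := fun k => by
    rw [← orient_rotate]
    exact orient_pos_of_axis hf hvr hc ha hca h k (by rwa [orient_rotate])
  have k3 : a 1 * b 1 ≤ 0 → 0 < orient a' b' v' := fun k => by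
    rw [← orient_rotate, ← orient_rotate]
    exact orient_pos_of_axis hf hvr ha hb hab h k (by rwa [orient_rotate b, orient_rotate])
  have hs0 := orient_bary a b c v 1
  rw [h, mul_zero] at hs0
  exact ⟨pos_of_balanced h1 h2 h3 hs0 hs ha.sign hb.sign hc.sign k1 k2 k3,
    pos_of_balanced h2 h3 h1 (by linarith) (by linarith) hb.sign hc.sign ha.sign k2 k3 k1,
    pos_of_balanced h3 h1 h2 (by linarith) (by linarith) hc.sign ha.sign hb.sign k3 k1 k2⟩

lemma PointRel.of_pos {u u' : Plane} (h : 0 < u 1) (h' : 0 < u' 1) : PointRel f u u' :=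
  ⟨by rw [sign_pos h, sign_pos h'], fun h0 => absurd h0 h.ne'⟩

lemma PointRel.crossRel_of_nonneg {u u' w w' : Plane} (hu : PointRel f u u')
    (hw : PointRel f w w') (hu1 : 0 < u 1) (hw1 : 0 ≤ w 1) : CrossRel f u u' w w' := by
  rcases hw1.eq_or_lt with h | h
  · exact hu.crossRel_right hw h.symm
  · exact crossRel_of_mul_pos (by positivity)

lemma PointRel.nonneg {u u' : Plane} (hu : PointRel f u u') (h : 0 ≤ u 1) : 0 ≤ u' 1 := by
  by_contra hc
  have := (sign_eq_iff_neg hu.sign).1 (not_le.1 hc)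
  linarith

/-- No edge from `v` crosses the axis, so any inner point above the axis will do; the centroid is
one because not all corners are on the axis. -/
lemma hasInsert_none (hv : Inside a b c v) (hD : 0 < orient a' b' c')
    (ha : PointRel f a a') (hb : PointRel f b b') (hc : PointRel f c c')
    (h : 0 < v 1) (ha1 : 0 ≤ a 1) (hb1 : 0 ≤ b 1) (hc1 : 0 ≤ c 1) :
    HasInsert f a b c v a' b' c' := by
  set v' : Plane := !₂[(a' 0 + b' 0 + c' 0) / 3, (a' 1 + b' 1 + c' 1) / 3] with hv'
  have v0 : v' 0 = (a' 0 + b' 0 + c' 0) / 3 := rfl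
  have v1 : v' 1 = (a' 1 + b' 1 + c' 1) / 3 := rfl
  have ha1' := ha.nonneg ha1
  have hb1' := hb.nonneg hb1
  have hc1' := hc.nonneg hc1
  have hpos : 0 < v' 1 := by
    by_contra hcon
    rw [v1] at hcon
    have ea : a 1 = 0 := (sign_eq_iff_zero ha.sign).1 (by linarith)
    have eb : b 1 = 0 := (sign_eq_iff_zero hb.sign).1 (by linarith)
    have ec : c 1 = 0 := (sign_eq_iff_zero hc.sign).1 (by linarith)
    have := orient_bary a b c v 1
    rw [ea, eb, ec] at this
    have := mul_pos hv.pos h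
    linarith
  have hvr : PointRel f v v' := .of_pos h hpos
  refine ⟨v', ?_, hvr, hvr.crossRel_of_nonneg ha h ha1, hvr.crossRel_of_nonneg hb h hb1,
    hvr.crossRel_of_nonneg hc h hc1⟩
  rw [orient_eq] at hD
  refine ⟨?_, ?_, ?_⟩ <;> rw [orient_eq, v0, v1] <;> linarith

/-- Only the edge from `v` to `a` crosses properly, which confines `v'` to a ray from `a'`. The two
orientations at `a'` then follow from the order of the crossings, and the third from choosing `v'`
close to the axis. -/
lemma hasInsert_one (hf : StrictMono f) (hv : Inside a b c v) (hD : 0 < orient a' b' c')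
    (ha : PointRel f a a') (hb : PointRel f b b') (hc : PointRel f c c')
    (hab : CrossRel f a a' b b') (hca : CrossRel f c c' a a')
    (h : 0 < v 1) (ha1 : a 1 < 0) (hb1 : 0 ≤ b 1) (hc1 : 0 ≤ c 1) :
    HasInsert f a b c v a' b' c' := by
  set t := f (crossing v a) with ht
  have ha1' : a' 1 < 0 := (sign_eq_iff_neg ha.sign).2 ha1
  -- The ray from `a'` through the prescribed crossing `(t, 0)`, which it reaches at `l = 1`.
  set P : ℝ → Plane := fun l => !₂[a' 0 + l * (t - a' 0), a' 1 * (1 - l)] with hP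
  have P0 : ∀ l, P l 0 = a' 0 + l * (t - a' 0) := fun l => rfl
  have P1 : ∀ l, P l 1 = a' 1 * (1 - l) := fun l => rfl
  have hr : ∀ l, 1 < l → PointRel f v (P l) := fun l hl => .of_pos h (by rw [P1]; nlinarith)
  have hca' : ∀ l, 1 < l → CrossRel f v (P l) a a' := by
    intro l hl _ _
    have : a' 1 - a' 1 * (1 - l) ≠ 0 := by
      have : a' 1 - a' 1 * (1 - l) = a' 1 * l := by ring
      rw [this]; exact mul_ne_zero ha1'.ne (by linarith)
    rw [← ht]
    unfold crossing
    rw [P0, P1, div_eq_iff this]; ring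
  have hBC : ∀ l, 1 < l → 0 < orient a' (P l) c' ∧ 0 < orient a' b' (P l) := fun l hl =>
    ⟨orient_pos_of_apex hf ha (hr l hl) hc (hca' l hl).symm hca.symm ha1.ne (by nlinarith)
      (by nlinarith) hv.2.1,
    orient_pos_of_apex hf ha hb (hr l hl) hab (hca' l hl).symm ha1.ne (by nlinarith)
      (by nlinarith) hv.2.2⟩
  set B := (t - a' 0) * (c' 1 - a' 1) + a' 1 * (c' 0 - a' 0) with hB
  set C := (b' 0 - a' 0) * -a' 1 - (b' 1 - a' 1) * (t - a' 0) with hC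
  have eB : ∀ l, orient a' (P l) c' = l * B := by
    intro l; rw [orient_eq, P0, P1, hB]; ring
  have eC : ∀ l, orient a' b' (P l) = l * C := by
    intro l; rw [orient_eq, P0, P1, hC]; ring
  have hB0 : 0 < B := by
    have := (hBC 2 one_lt_two).1
    rw [eB] at this; linarith
  have hC0 : 0 < C := by
    have := (hBC 2 one_lt_two).2
    rw [eC] at this; linarith
  have hb1' := hb.nonneg hb1
  have hc1' := hc.nonneg hc1
  have hbc : 0 < b' 1 ∨ 0 < c' 1 := by
    by_contra! hcon
    have eb : b 1 = 0 := (sign_eq_iff_zero hb.sign).1 (by linarith)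
    have ec : c 1 = 0 := (sign_eq_iff_zero hc.sign).1 (by linarith)
    have := orient_bary a b c v 1
    rw [eb, ec] at this
    have := mul_pos hv.pos h
    have := mul_neg_of_pos_of_neg hv.1 ha1
    linarith
  set K := B * b' 1 + C * c' 1 with hK
  have hK0 : 0 < K := by
    rcases hbc with hh | hh
    · have := mul_pos hB0 hh
      have := mul_nonneg hC0.le hc1'
      linarith
    · have := mul_pos hC0 hh
      have := mul_nonneg hB0.le hb1'
      linarith
  set D := orient a' b' c' with hDd
  have hDa : 0 < D * -a' 1 := mul_pos hD (by linarith)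
  -- The third orientation is positive exactly when `D * -a' 1 * (l - 1) < l * K`; here the left
  -- side equals `K`, and `l > 1`.
  set l := 1 + K / (D * -a' 1) with hl
  have hl1 : 1 < l := by
    have : 0 < K / (D * -a' 1) := by positivity
    linarith
  have hlK : (D * -a' 1) * (l - 1) = K := by
    have hn : a' 1 ≠ 0 := ha1'.ne
    rw [hl]; field_simp; ring
  refine ⟨P l, ⟨?_, (hBC l hl1).1, (hBC l hl1).2⟩, hr l hl1, hca' l hl1,
    (hr l hl1).crossRel_of_nonneg hb h hb1, (hr l hl1).crossRel_of_nonneg hc h hc1⟩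
  have hs := orient_bary a' b' c' (P l) 1
  rw [eB, eC, P1, ← hDd] at hs
  have h1 : orient (P l) b' c' * a' 1 = K - l * K := by
    linear_combination hs + hlK + l * hK
  have h2 : orient (P l) b' c' * a' 1 < 0 := by
    rw [h1]; nlinarith
  by_contra hcon
  have := mul_nonneg_of_nonpos_of_nonpos (not_lt.1 hcon) ha1'.le
  linarith

/-- Two crossings are prescribed, so `v'` must be the intersection of the lines from `a'` and `b'`
through them. What needs proof is that these lines meet above the axis. -/
lemma hasInsert_two (hf : StrictMono f) (hv : Inside a b c v)
    (ha : PointRel f a a') (hb : PointRel f b b') (hc : PointRel f c c')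
    (hbc : CrossRel f b b' c c') (hca : CrossRel f c c' a a')
    (h : 0 < v 1) (ha1 : a 1 < 0) (hb1 : b 1 < 0) (hc1 : 0 < c 1) :
    HasInsert f a b c v a' b' c' := by
  obtain ⟨o1, o2, o3⟩ := hv
  have hca0 := hca.symm (mul_neg_of_neg_of_pos ha1 hc1).le (Or.inl ha1.ne)
  have hbc0 := hbc (mul_neg_of_neg_of_pos hb1 hc1).le (Or.inl hb1.ne)
  have va := (mul_neg_of_pos_of_neg h ha1).le
  have vb := (mul_neg_of_pos_of_neg h hb1).le
  have av := (mul_neg_of_neg_of_pos ha1 h).le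
  have bv := (mul_neg_of_neg_of_pos hb1 h).le
  have ac := (mul_neg_of_neg_of_pos ha1 hc1).le
  have bc := (mul_neg_of_neg_of_pos hb1 hc1).le
  rw [← orient_rotate] at o1
  rw [← orient_rotate, ← orient_rotate] at o3
  have i1 : f (crossing v b) < crossing b' c' := by
    rw [hbc0]; apply hf
    have := (orient_pos_iff_crossing hb1.ne bc bv).1 o1
    rw [crossing_comm v b]; nlinarith
  have i2 : crossing a' c' < f (crossing v a) := by
    rw [hca0]; apply hf
    have := (orient_pos_iff_crossing ha1.ne av ac).1 o2
    rw [crossing_comm v a]; nlinarith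
  have i3 : f (crossing v a) < f (crossing v b) := by
    apply hf
    have := (orient_pos_iff_crossing h.ne' va vb).1 o3
    nlinarith
  set t1 := f (crossing v a) with ht1
  set t2 := f (crossing v b) with ht2
  have ha1' : a' 1 < 0 := (sign_eq_iff_neg ha.sign).2 ha1
  have hb1' : b' 1 < 0 := (sign_eq_iff_neg hb.sign).2 hb1
  have hc1' : 0 < c' 1 := (sign_eq_iff_pos hc.sign).2 hc1
  set s1 := crossing a' c' with hs1
  set s2 := crossing b' c' with hs2
  have e1 : (a' 0 - s1) / a' 1 = (c' 0 - s1) / c' 1 := by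
    have k1 : c' 1 - a' 1 ≠ 0 := by linarith
    have k2 := ha1'.ne
    have k3 : c' 1 ≠ 0 := hc1'.ne'
    rw [hs1]; unfold crossing; field_simp; ring
  have e2 : (b' 0 - s2) / b' 1 = (c' 0 - s2) / c' 1 := by
    have k1 : c' 1 - b' 1 ≠ 0 := by linarith
    have k2 := hb1'.ne
    have k3 : c' 1 ≠ 0 := hc1'.ne'
    rw [hs2]; unfold crossing; field_simp; ring
  -- The difference of the inverse slopes of the two lines; it is positive by comparison with the
  -- sides `a' c'` and `b' c'`, which meet above the axis at `c'` and cross it farther out.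
  set S := (a' 0 - t1) / a' 1 - (b' 0 - t2) / b' 1 with hS
  have hS0 : 0 < S := by
    have : S = (s2 - s1) / c' 1 + (s1 - t1) / a' 1 + (t2 - s2) / b' 1 := by
      have : S = ((a' 0 - s1) / a' 1 + (s1 - t1) / a' 1) -
          ((b' 0 - s2) / b' 1 + (s2 - t2) / b' 1) := by
        rw [hS]; ring
      rw [this, e1, e2]; ring
    rw [this]
    have q1 : 0 < (s2 - s1) / c' 1 := div_pos (by linarith) hc1'
    have q2 : 0 < (s1 - t1) / a' 1 := div_pos_of_neg_of_neg (by linarith) ha1'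
    have q3 : 0 < (t2 - s2) / b' 1 := div_pos_of_neg_of_neg (by linarith) hb1'
    linarith
  -- The height at which the two lines have the same abscissa.
  set y := (t2 - t1) / S with hy
  have hy0 : 0 < y := div_pos (by linarith) hS0
  have hyS : y * S = t2 - t1 := by rw [hy]; field_simp
  set v' : Plane := !₂[t1 + y * ((a' 0 - t1) / a' 1), y] with hv'
  have v0 : v' 0 = t1 + y * ((a' 0 - t1) / a' 1) := rfl
  have v0' : v' 0 = t2 + y * ((b' 0 - t2) / b' 1) := by rw [v0]; linear_combination hyS
  have v1 : v' 1 = y := rfl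
  have hvr : PointRel f v v' := .of_pos h hy0
  have cva : CrossRel f v v' a a' := by
    intro _ _
    rw [← ht1]
    unfold crossing
    have k1 : a' 1 - y ≠ 0 := by linarith
    have k2 := ha1'.ne
    rw [v0, v1, div_eq_iff k1]; field_simp; ring
  have cvb : CrossRel f v v' b b' := by
    intro _ _
    rw [← ht2]
    unfold crossing
    have k1 : b' 1 - y ≠ 0 := by linarith
    have k2 := hb1'.ne
    rw [v0', v1, div_eq_iff k1]; field_simp; ring
  refine ⟨v', ⟨?_, ?_, ?_⟩, hvr, cva, cvb, crossRel_of_mul_pos (mul_pos h hc1)⟩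
  · rw [← orient_rotate]
    exact orient_pos_of_apex hf hb hc hvr hbc cvb.symm hb1.ne bc bv o1
  · exact orient_pos_of_apex hf ha hvr hc cva.symm hca.symm ha1.ne av ac o2
  · rw [← orient_rotate, ← orient_rotate]
    exact orient_pos_of_apex hf hvr ha hb cva cvb h.ne' va vb o3

/-- The cases are the numbers of corners below the axis. Three are impossible, and with two the
remaining corner is strictly above, since `v` is a convex combination of the corners. -/
lemma hasInsert_pos (hf : StrictMono f) (hv : Inside a b c v) (hD : 0 < orient a' b' c')
    (ha : PointRel f a a') (hb : PointRel f b b') (hc : PointRel f c c')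
    (hab : CrossRel f a a' b b') (hbc : CrossRel f b b' c c') (hca : CrossRel f c c' a a')
    (h : 0 < v 1) : HasInsert f a b c v a' b' c' := by
  have hD1 : 0 < orient b' c' a' := by rwa [orient_rotate]
  have hD2 : 0 < orient c' a' b' := by rwa [orient_rotate b', orient_rotate]
  have hb0 := orient_bary a b c v 1
  have hDv := mul_pos hv.pos h
  have nz : ∀ {x y : ℝ}, 0 < x → y < 0 → x * y < 0 := fun hx hy => mul_neg_of_pos_of_neg hx hy
  rcases lt_or_ge (a 1) 0 with ha1 | ha1 <;> rcases lt_or_ge (b 1) 0 with hb1 | hb1 <;>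
    rcases lt_or_ge (c 1) 0 with hc1 | hc1
  · linarith [nz hv.1 ha1, nz hv.2.1 hb1, nz hv.2.2 hc1]
  · refine hasInsert_two hf hv ha hb hc hbc hca h ha1 hb1 (hc1.lt_of_ne ?_)
    intro h0
    rw [← h0] at hb0
    linarith [nz hv.1 ha1, nz hv.2.1 hb1]
  · refine (hasInsert_two hf hv.rotate.rotate hc ha hb hab hbc h hc1 ha1
      (hb1.lt_of_ne ?_)).rotate.rotate
    intro h0
    rw [← h0] at hb0
    linarith [nz hv.1 ha1, nz hv.2.2 hc1]
  · exact hasInsert_one hf hv hD ha hb hc hab hca h ha1 hb1 hc1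
  · refine (hasInsert_two hf hv.rotate hb hc ha hca hab h hb1 hc1 (ha1.lt_of_ne ?_)).rotate
    intro h0
    rw [← h0] at hb0
    linarith [nz hv.2.1 hb1, nz hv.2.2 hc1]
  · exact (hasInsert_one hf hv.rotate hD1 hb hc ha hbc hab h hb1 hc1 ha1).rotate
  · exact (hasInsert_one hf hv.rotate.rotate hD2 hc ha hb hca hbc h hc1 ha1 hb1).rotate.rotate
  · exact hasInsert_none hv hD ha hb hc h ha1 hb1 hc1

lemma orient_neg_neg (x y z : Plane) : orient (-x) (-y) (-z) = orient x y z := by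
  simp [orient_eq]; ring

lemma crossing_neg_neg (x y : Plane) : crossing (-x) (-y) = -crossing x y := by
  simp only [crossing, PiLp.neg_apply]
  rw [← neg_div_neg_eq, ← neg_div]
  congr 1 <;> ring

lemma PointRel.neg {u u' : Plane} (h : PointRel f u u') :
    PointRel (fun x => -f (-x)) (-u) (-u') :=
  ⟨by simp [Left.sign_neg, h.sign], fun h0 => by simpa using h.axis (by simpa using h0)⟩

lemma CrossRel.neg {u u' w w' : Plane} (h : CrossRel f u u' w w') :
    CrossRel (fun x => -f (-x)) (-u) (-u') (-w) (-w') := fun h1 h2 => by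
  simp only [crossing_neg_neg, neg_neg]
  rw [h (by simpa using h1) (by simpa using h2)]

/-- A vertex below the axis is reduced to one above it by a half-turn, which preserves orientation
and replaces `f` by `x ↦ -f (-x)`. -/
lemma hasInsert (hf : StrictMono f) (hv : Inside a b c v) (hD : 0 < orient a' b' c')
    (ha : PointRel f a a') (hb : PointRel f b b') (hc : PointRel f c c')
    (hab : CrossRel f a a' b b') (hbc : CrossRel f b b' c c') (hca : CrossRel f c c' a a') :
    HasInsert f a b c v a' b' c' := by
  rcases lt_trichotomy (v 1) 0 with h | h | h
  · have hf' : StrictMono fun x => -f (-x) := fun x y hxy => by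
      simpa using hf (neg_lt_neg hxy)
    have hv' : Inside (-a) (-b) (-c) (-v) := by
      simpa only [Inside, orient_neg_neg] using hv
    obtain ⟨w, h1, h2, h3, h4, h5⟩ := hasInsert_pos hf' hv' (by rwa [orient_neg_neg]) ha.neg
      hb.neg hc.neg hab.neg hbc.neg hca.neg (by simpa using h)
    refine ⟨-w, ?_, by simpa using h2.neg, by simpa using h3.neg, by simpa using h4.neg,
      by simpa using h5.neg⟩
    rw [← neg_neg a', ← neg_neg b', ← neg_neg c']
    simpa only [Inside, orient_neg_neg] using h1
  · exact hasInsert_axis hf hv ha hb hc hab hbc hca h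
  · exact hasInsert_pos hf hv hD ha hb hc hab hbc hca h

end Insert

/-! ### The root triangle and the realization of a whole drawing -/

/-- All points in which the triangle `a b c` meets the horizontal axis transversally are among
two given points. -/
def AtMostTwo (e e' : ℝ) (a b c : Plane) : Prop :=
  ((a 1 = 0 → a 0 = e ∨ a 0 = e') ∧ (b 1 = 0 → b 0 = e ∨ b 0 = e') ∧
    (c 1 = 0 → c 0 = e ∨ c 0 = e')) ∧
  (a 1 * b 1 ≤ 0 → (a 1 ≠ 0 ∨ b 1 ≠ 0) → crossing a b = e ∨ crossing a b = e') ∧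
  (b 1 * c 1 ≤ 0 → (b 1 ≠ 0 ∨ c 1 ≠ 0) → crossing b c = e ∨ crossing b c = e') ∧
  (c 1 * a 1 ≤ 0 → (c 1 ≠ 0 ∨ a 1 ≠ 0) → crossing c a = e ∨ crossing c a = e')

lemma AtMostTwo.rotate {e e' : ℝ} {a b c : Plane} (h : AtMostTwo e e' b c a) :
    AtMostTwo e e' a b c := by
  obtain ⟨⟨h1, h2, h3⟩, h4, h5, h6⟩ := h
  exact ⟨⟨h3, h1, h2⟩, h6, h4, h5⟩

lemma atMostTwo_apex {a b c : Plane} (h : a 1 ≠ 0) (hb : a 1 * b 1 ≤ 0) (hc : a 1 * c 1 ≤ 0) :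
    AtMostTwo (crossing a b) (crossing a c) a b c := by
  refine ⟨⟨fun h0 => absurd h0 h, fun h0 => Or.inl (crossing_of_right h0 h).symm,
    fun h0 => Or.inr (crossing_of_right h0 h).symm⟩, fun _ _ => Or.inl rfl, fun h1 h2 => ?_,
    fun _ _ => Or.inr (crossing_comm _ _)⟩
  by_cases hb0 : b 1 = 0
  · have hc0 : c 1 ≠ 0 := h2.resolve_left fun k => k hb0
    left; rw [crossing_of_left hb0 hc0, crossing_of_right hb0 h]
  by_cases hc0 : c 1 = 0
  · right; rw [crossing_of_right hc0 hb0, crossing_of_right hc0 h]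
  exfalso
  have k1 : a 1 * b 1 < 0 := lt_of_le_of_ne hb (mul_ne_zero h hb0)
  have k2 : a 1 * c 1 < 0 := lt_of_le_of_ne hc (mul_ne_zero h hc0)
  have k3 : b 1 * c 1 < 0 := lt_of_le_of_ne h1 (mul_ne_zero hb0 hc0)
  have : (a 1 * b 1) * (a 1 * c 1) = (a 1 * a 1) * (b 1 * c 1) := by ring
  have k4 := mul_pos_of_neg_of_neg k1 k2
  have k5 := mul_neg_of_pos_of_neg (mul_self_pos.2 h) k3
  linarith

lemma atMostTwo_side {a b c : Plane} (hbc : 0 < b 1 * c 1) (hb : 0 ≤ a 1 * b 1) :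
    AtMostTwo (a 0) (a 0) a b c := by
  have hb0 : b 1 ≠ 0 := fun h => by rw [h] at hbc; simp at hbc
  have hc0 : c 1 ≠ 0 := fun h => by rw [h] at hbc; simp at hbc
  have hc : 0 ≤ a 1 * c 1 := by
    by_contra hcon
    have h1 := mul_nonpos_of_nonneg_of_nonpos hb (not_le.1 hcon).le
    have h2 : (a 1 * b 1) * (a 1 * c 1) = (a 1 * a 1) * (b 1 * c 1) := by ring
    have ha : a 1 ≠ 0 := fun h => by rw [h] at hcon; simp at hcon
    have := mul_pos (mul_self_pos.2 ha) hbc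
    linarith
  have key : ∀ x : Plane, x 1 ≠ 0 → a 1 * x 1 ≤ 0 → 0 ≤ a 1 * x 1 → a 1 = 0 := fun x hx h1 h2 =>
    (mul_eq_zero.1 (le_antisymm h1 h2)).resolve_right hx
  refine ⟨⟨fun _ => Or.inl rfl, fun h => absurd h hb0, fun h => absurd h hc0⟩, fun h1 _ => ?_,
    fun h1 => absurd h1 (not_le.2 hbc), fun h1 _ => ?_⟩
  · exact Or.inl (crossing_of_left (key b hb0 h1 hb) hb0)
  · exact Or.inl (crossing_of_right (key c hc0 (by rwa [mul_comm]) hc) hc0)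

/-- If two corners are strictly on one side, either only the third can touch the axis or the third
is an apex across it. If no two are, any corner off the axis is such an apex. -/
lemma exists_atMostTwo {a b c : Plane} (h : 0 < orient a b c) :
    ∃ e e', AtMostTwo e e' a b c := by
  have main : ∀ {a b c : Plane}, 0 < b 1 * c 1 → ∃ e e', AtMostTwo e e' a b c := by
    intro a b c hbc
    by_cases hab : 0 ≤ a 1 * b 1
    · exact ⟨_, _, atMostTwo_side hbc hab⟩
    · rw [not_le] at hab
      have ha : a 1 ≠ 0 := fun h => by rw [h] at hab; simp at hab
      refine ⟨_, _, atMostTwo_apex ha hab.le ?_⟩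
      by_contra hcon
      have h2 : (a 1 * b 1) * (a 1 * c 1) = (a 1 * a 1) * (b 1 * c 1) := by ring
      have := mul_pos (mul_self_pos.2 ha) hbc
      have := mul_neg_of_neg_of_pos hab (not_le.1 hcon)
      linarith
  by_cases h1 : 0 < b 1 * c 1
  · exact main h1
  by_cases h2 : 0 < c 1 * a 1
  · obtain ⟨e, e', he⟩ := main (a := b) h2
    exact ⟨e, e', he.rotate⟩
  by_cases h3 : 0 < a 1 * b 1
  · obtain ⟨e, e', he⟩ := main (a := c) h3
    exact ⟨e, e', he.rotate.rotate⟩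
  rw [not_lt] at h1 h2 h3
  by_cases ha : a 1 = 0
  · by_cases hb : b 1 = 0
    · have hc : c 1 ≠ 0 := by
        intro hc
        rw [orient_eq, ha, hb, hc] at h; simp at h
      exact ⟨_, _, (atMostTwo_apex hc h2 (by rwa [mul_comm])).rotate.rotate⟩
    · exact ⟨_, _, (atMostTwo_apex hb h1 (by rwa [mul_comm])).rotate⟩
  · exact ⟨_, _, atMostTwo_apex ha h3 (by rwa [mul_comm])⟩

lemma StrictMono.exists_affine_eq {f : ℝ → ℝ} (hf : StrictMono f) (e e' : ℝ) :
    ∃ α β : ℝ, 0 < α ∧ ∀ x, x = e ∨ x = e' → f x = α * x + β := by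
  by_cases h : e = e'
  · subst h
    exact ⟨1, f e - e, one_pos, by rintro x (rfl | rfl) <;> ring⟩
  · have h' : e' - e ≠ 0 := sub_ne_zero.2 (Ne.symm h)
    refine ⟨(f e' - f e) / (e' - e), f e - (f e' - f e) / (e' - e) * e, ?_, ?_⟩
    · rcases lt_or_gt_of_ne h with h | h
      · exact div_pos (sub_pos.2 (hf h)) (sub_pos.2 h)
      · exact div_pos_of_neg_of_neg (sub_neg.2 (hf h)) (sub_neg.2 h)
    · rintro x (rfl | rfl)
      · ring
      · field_simp; ring

/-- The horizontal affine map `x ↦ α x + β`. -/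
noncomputable def stretch (α β : ℝ) (x : Plane) : Plane := !₂[α * x 0 + β, x 1]

lemma orient_stretch (α β : ℝ) (x y z : Plane) :
    orient (stretch α β x) (stretch α β y) (stretch α β z) = α * orient x y z := by
  simp [orient_eq, stretch]; ring

lemma crossing_stretch {α β : ℝ} {x y : Plane} (h : y 1 - x 1 ≠ 0) :
    crossing (stretch α β x) (stretch α β y) = α * crossing x y + β := by
  simp [crossing, stretch]; field_simp; ring

section Realization

variable {V : Type*}

theorem Stacked.exists_realization {G : SimpleGraph V} {a b c : V} {s : Set V}
    {F : Set (V × V × V)} (h : Stacked G a b c s F) {p : V → Plane} (hp : Positive p F)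
    {f : ℝ → ℝ} (hf : StrictMono f) :
    ∃ q : V → Plane, Positive q F ∧ (∀ v ∈ s, PointRel f (p v) (q v)) ∧
      ∀ u ∈ s, ∀ v ∈ s, G.Adj u v → CrossRel f (p u) (q u) (p v) (q v) := by
  induction h with
  | base hab hbc hca =>
    have hD : 0 < orient (p a) (p b) (p c) := hp _ rfl
    obtain ⟨e, e', ⟨h1, h2, h3⟩, h4, h5, h6⟩ := exists_atMostTwo hD
    -- The root triangle sees `f` at only two points, where an increasing affine map replaces it.
    obtain ⟨α, β, hα, hfe⟩ := hf.exists_affine_eq e e'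
    have pt : ∀ x : Plane, (x 1 = 0 → x 0 = e ∨ x 0 = e') → PointRel f x (stretch α β x) :=
      fun x hx => ⟨rfl, fun h0 => (hfe _ (hx h0)).symm⟩
    have cr : ∀ x y : Plane, (x 1 * y 1 ≤ 0 → (x 1 ≠ 0 ∨ y 1 ≠ 0) → crossing x y = e ∨
        crossing x y = e') → CrossRel f x (stretch α β x) y (stretch α β y) := by
      intro x y hxy k1 k2
      rw [hfe _ (hxy k1 k2)]
      apply crossing_stretch
      rcases k2 with k2 | k2
      · intro h0; exact sub_ne_zero_of_mul_nonpos k2 k1 (by linarith)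
      · exact sub_ne_zero_of_mul_nonpos k2 (by rwa [mul_comm])
    have cab := cr _ _ h4
    have cbc := cr _ _ h5
    have cca := cr _ _ h6
    refine ⟨fun v => stretch α β (p v), ?_, ?_, ?_⟩
    · rintro g rfl
      simp only [orient_stretch]
      positivity
    · rintro v (rfl | rfl | rfl)
      exacts [pt _ h1, pt _ h2, pt _ h3]
    · rintro u (rfl | rfl | rfl) v (rfl | rfl | rfl) huv <;>
        first
        | exact absurd rfl huv.ne
        | assumption
        | (apply CrossRel.symm; assumption)
  | step s F x y z v h hfc hv hadj ih =>
    classical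
    obtain ⟨q, hq, hpt, hcr⟩ := ih hp.of_subdivide
    have I := h.invariant hp.of_subdivide
    have hin := (positive_subdivide.1 hp).2
    obtain ⟨hx, hy, hz⟩ := I.face_mem x y z hfc
    obtain ⟨hxy, hyz, hzx⟩ := I.face_adj x y z hfc
    obtain ⟨v', k1, k2, k3, k4, k5⟩ := hasInsert hf hin (hq _ hfc) (hpt x hx) (hpt y hy)
      (hpt z hz) (hcr x hx y hy hxy) (hcr y hy z hz hyz) (hcr z hz x hx hzx)
    set r := Function.update q v v' with hr
    have rv : r v = v' := Function.update_self ..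
    have rs : ∀ u ∈ s, r u = q u := fun u hu =>
      Function.update_of_ne (fun h : u = v => hv (h ▸ hu)) _ _
    refine ⟨r, positive_subdivide.2 ⟨?_, ?_⟩, ?_, ?_⟩
    · rintro ⟨a', b', c'⟩ ⟨hg, -⟩
      obtain ⟨m1, m2, m3⟩ := I.face_mem _ _ _ hg
      simp only [rs _ m1, rs _ m2, rs _ m3]
      exact hq _ hg
    · rwa [rv, rs x hx, rs y hy, rs z hz]
    · rintro u (rfl | hu)
      · rwa [rv]
      · rw [rs u hu]; exact hpt u hu
    · have new : ∀ u ∈ s, G.Adj v u → CrossRel f (p v) (r v) (p u) (r u) := by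
        intro u hu hvu
        rw [rv, rs u hu]
        rcases (hadj u hu).1 hvu with rfl | rfl | rfl <;> assumption
      rintro u (rfl | hu) w (rfl | hw) huw
      · exact absurd rfl huw.ne
      · exact new w hw huw
      · exact (new u hu huw.symm).symm
      · rw [rs u hu, rs w hw]; exact hcr u hu w hw huw

end Realization

/-! ### Interpolation by a strictly increasing function -/

/-- Finitely many slopes have a positive lower bound `ε`. Subtracting `ε * z` leaves monotone data,
which extend to a monotone function; adding `ε * z` back makes it strict. -/
lemma exists_strictMono_extension {ι : Type*} [Finite ι] {A : Set ι} {r t : ι → ℝ}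
    (h : ∀ x ∈ A, ∀ y ∈ A, r x < r y → t x < t y)
    (h' : ∀ x ∈ A, ∀ y ∈ A, r x = r y → t x = t y) :
    ∃ f : ℝ → ℝ, StrictMono f ∧ ∀ x ∈ A, f (r x) = t x := by
  obtain ⟨ε, hε, hlip⟩ : ∃ ε : ℝ, 0 < ε ∧ ∀ x ∈ A, ∀ y ∈ A, r x < r y →
      ε * (r y - r x) ≤ t y - t x := by
    have key : ∀ᶠ ε in nhdsWithin (0 : ℝ) (Set.Ioi 0), ∀ x y, x ∈ A → y ∈ A → r x < r y →
        ε * (r y - r x) ≤ t y - t x := by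
      rw [Filter.eventually_all]; intro x
      rw [Filter.eventually_all]; intro y
      by_cases hxy : x ∈ A ∧ y ∈ A ∧ r x < r y
      · have hc : Continuous fun ε : ℝ => ε * (r y - r x) := by fun_prop
        have h0 : (0 : ℝ) * (r y - r x) < t y - t x := by
          have := h x hxy.1 y hxy.2.1 hxy.2.2
          linarith
        filter_upwards [(hc.continuousAt.eventually_lt_const h0).filter_mono
          nhdsWithin_le_nhds] with ε hε _ _ _ using hε.le
      · exact Filter.Eventually.of_forall fun ε h1 h2 h3 => absurd ⟨h1, h2, h3⟩ hxy
    obtain ⟨ε, h1, h2⟩ := (key.and self_mem_nhdsWithin).exists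
    exact ⟨ε, h2, fun x hx y hy hxy => h1 x y hx hy hxy⟩
  classical
  have hk : ∀ z : ℝ, ∃ k : ℝ, ∀ x ∈ A, r x = z → k = t x - ε * z := by
    intro z
    by_cases hz : ∃ x ∈ A, r x = z
    · obtain ⟨x, hx, rfl⟩ := hz
      exact ⟨t x - ε * r x, fun y hy hyx => by rw [h' y hy x hx hyx]⟩
    · exact ⟨0, fun x hx hxz => absurd ⟨x, hx, hxz⟩ hz⟩
  choose k hk using hk
  have hmono : MonotoneOn k (r '' A) := by
    rintro _ ⟨x, hx, rfl⟩ _ ⟨y, hy, rfl⟩ hxy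
    rw [hk _ x hx rfl, hk _ y hy rfl]
    rcases hxy.eq_or_lt with e | e
    · rw [h' x hx y hy e, e]
    · linarith [hlip x hx y hy e]
  have hfin : (k '' (r '' A)).Finite := ((Set.toFinite A).image r).image k
  obtain ⟨g, hg, hgk⟩ := hmono.exists_monotone_extension hfin.bddBelow hfin.bddAbove
  refine ⟨fun z => g z + ε * z, fun x y hxy => ?_, fun x hx => ?_⟩
  · have := hg hxy.le
    have := mul_lt_mul_of_pos_left hxy hε
    show g x + ε * x < g y + ε * y
    linarith
  · show g (r x) + ε * r x = t x
    rw [← hgk ⟨x, hx, rfl⟩, hk _ x hx rfl]; ring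

/-! ### Transfer to an arbitrary line and proof of the theorem -/

/-- The similarity that maps the horizontal axis to the line `{a + s • d | s ∈ ℝ}`. -/
noncomputable def sim (a d z : Plane) : Plane := a + z 0 • d + z 1 • rotateLeft d

/-- The coordinates with respect to the line `{a + s • d | s ∈ ℝ}`. -/
noncomputable def coord (a d x : Plane) : Plane :=
  !₂[((x 0 - a 0) * d 0 + (x 1 - a 1) * d 1) / (d 0 ^ 2 + d 1 ^ 2),
    side a d x / (d 0 ^ 2 + d 1 ^ 2)]

lemma sim_zero (a d z : Plane) : sim a d z 0 = a 0 + z 0 * d 0 - z 1 * d 1 := by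
  simp [sim, rotateLeft]; ring

lemma sim_one (a d z : Plane) : sim a d z 1 = a 1 + z 0 * d 1 + z 1 * d 0 := by
  simp [sim, rotateLeft]

lemma sim_coord {a d : Plane} (hd : d ≠ 0) (x : Plane) : sim a d (coord a d x) = x := by
  have h := (sq_add_sq_pos hd).ne'
  apply plane_ext
  · rw [sim_zero]; simp [coord, side, cross]; field_simp; ring
  · rw [sim_one]; simp [coord, side, cross]; field_simp; ring

lemma orient_sim (a d x y z : Plane) :
    orient (sim a d x) (sim a d y) (sim a d z) = (d 0 ^ 2 + d 1 ^ 2) * orient x y z := by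
  simp only [orient_eq, sim_zero, sim_one]; ring

lemma side_sim (a d x : Plane) : side a d (sim a d x) = (d 0 ^ 2 + d 1 ^ 2) * x 1 := by
  simp only [side, cross, PiLp.sub_apply, sim_zero, sim_one]; ring

lemma sim_of_axis {a d x : Plane} (h : x 1 = 0) : sim a d x = a + x 0 • d := by
  simp [sim, h]

lemma side_line (a d : Plane) (s : ℝ) : side a d (a + s • d) = 0 := by
  simp [side, cross]; ring

lemma mem_segment_sim {a d x y : Plane} (hx : 0 < x 1) (hy : y 1 < 0) :
    a + crossing x y • d ∈ segment ℝ (sim a d x) (sim a d y) := by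
  have hxy : 0 < x 1 - y 1 := by linarith
  have hxy' : y 1 - x 1 ≠ 0 := by linarith
  refine mem_segment_iff_coord.2 ⟨x 1 / (x 1 - y 1), by positivity, ?_, fun i => ?_⟩
  · rw [div_le_one hxy]; linarith
  · have e : crossing x y = (x 1 * y 0 - y 1 * x 0) / (x 1 - y 1) := by
      unfold crossing; rw [← neg_div_neg_eq]; congr 1 <;> ring
    rw [e]
    fin_cases i
    · simp only [Fin.zero_eta, PiLp.add_apply, PiLp.smul_apply, smul_eq_mul, sim_zero]
      field_simp; ring
    · simp only [Fin.mk_one, PiLp.add_apply, PiLp.smul_apply, smul_eq_mul, sim_one]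
      field_simp; ring

section Main

variable {V : Type*}

lemma cell_edge (p : V → Plane) (u v : V) :
    cell p (Sum.inr s(u, v)) = segment ℝ (p u) (p v) := by
  have : {w | w ∈ s(u, v)} = ({u, v} : Set V) := by ext; simp
  rw [cell, this, convexHull_image_pair]

/-- The elements on the line meet it in points that `f` moves as it moves the crossings. -/
lemma exists_mem_cell {G : SimpleGraph V} {a d : Plane} {p : V → Plane} {x : V ⊕ Sym2 V}
    (hd : d ≠ 0) (hx : x ∈ lineElements G (fun v => sim a d (p v)) a d) :
    ∃ s : ℝ, a + s • d ∈ cell (fun v => sim a d (p v)) x ∧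
      ∀ (f : ℝ → ℝ) (q : V → Plane), (∀ v, PointRel f (p v) (q v)) →
        (∀ u v, G.Adj u v → CrossRel f (p u) (q u) (p v) (q v)) →
        a + f s • d ∈ cell (fun v => sim a d (q v)) x := by
  have hn := sq_add_sq_pos hd
  rcases hx with ⟨v, rfl, hv⟩ | ⟨u, v, rfl, huv, hu, hv⟩
  · rw [side_sim] at hv
    have hv : p v 1 = 0 := (mul_eq_zero.1 hv).resolve_left hn.ne'
    refine ⟨p v 0, ?_, fun f q hq _ => ?_⟩
    · exact (sim_of_axis hv).symm
    · have := sim_of_axis (a := a) (d := d) ((sign_eq_iff_zero (hq v).sign).2 hv)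
      rw [(hq v).axis hv] at this
      exact this.symm
  · rw [side_sim] at hu hv
    have hu : 0 < p u 1 := (pos_iff_pos_of_mul_pos hu).1 hn
    have hv : p v 1 < 0 := by
      by_contra hc
      have := mul_nonneg hn.le (not_lt.1 hc)
      linarith
    refine ⟨crossing (p u) (p v), ?_, fun f q hq hc => ?_⟩
    · rw [cell_edge]; exact mem_segment_sim hu hv
    · rw [cell_edge, ← hc u v huv (mul_neg_of_pos_of_neg hu hv).le (Or.inl hu.ne')]
      exact mem_segment_sim ((sign_eq_iff_pos (hq u).sign).2 hu)
        ((sign_eq_iff_neg (hq v).sign).2 hv)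

/-- Distinct elements cannot share a point of the line: two edges share only ends, and the ends of a
crossing edge lie off the line. Hence a position on the line determines its element. -/
lemma IsPlanarDrawing.eq_of_mem_cell {G : SimpleGraph V} {p : V → Plane}
    (hp : IsPlanarDrawing G p) {a d : Plane} {x y : V ⊕ Sym2 V} (hx : x ∈ lineElements G p a d)
    (hy : y ∈ lineElements G p a d) {w : Plane} (hw : side a d w = 0) (hwx : w ∈ cell p x)
    (hwy : w ∈ cell p y) : x = y := by
  have mixed : ∀ k u v, G.Adj u v → 0 < side a d (p u) → side a d (p v) < 0 →
      side a d (p k) = 0 → p k ∉ segment ℝ (p u) (p v) := by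
    intro k u v huv hu hv hk
    apply hp.vertex_notMem u v k huv
    · rintro rfl; exact hu.ne' hk
    · rintro rfl; exact hv.ne hk
  rcases hx with ⟨k, rfl, hk⟩ | ⟨u, v, rfl, huv, hu, hv⟩ <;>
    rcases hy with ⟨l, rfl, hl⟩ | ⟨u', v', rfl, huv', hu', hv'⟩
  · have h1 : w = p k := hwx
    have h2 : w = p l := hwy
    rw [hp.injective (h1.symm.trans h2)]
  · have h1 : w = p k := hwx
    rw [cell_edge, h1] at hwy
    exact absurd hwy (mixed k u' v' huv' hu' hv' hk)
  · have h1 : w = p l := hwy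
    rw [cell_edge, h1] at hwx
    exact absurd hwx (mixed l u v huv hu hv hl)
  · rw [cell_edge] at hwx hwy
    by_contra hne
    obtain ⟨k, ⟨hk, -⟩, rfl⟩ := hp.edge_inter u v u' v' huv huv'
      (fun h => hne (by rw [h])) ⟨hwx, hwy⟩
    rcases hk with rfl | rfl
    · exact hu.ne' hw
    · exact hv.ne hw

/-- A similarity multiplies every `orient` by a positive constant, so one realization in coordinates
yields a drawing for every target line at once. -/
theorem PlaneGraph.IsPlane3Tree.exists_coordinates [Fintype V] {G : PlaneGraph V}
    (hG : G.IsPlane3Tree) {p : V → Plane} {a d : Plane} (hd : d ≠ 0)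
    (hp : G.IsDrawing fun v => sim a d (p v)) {f : ℝ → ℝ} (hf : StrictMono f) :
    ∃ q : V → Plane, (∀ v, PointRel f (p v) (q v)) ∧
      (∀ u v, G.graph.Adj u v → CrossRel f (p u) (q u) (p v) (q v)) ∧
      ∀ a' d' : Plane, d' ≠ 0 → G.IsDrawing fun v => sim a' d' (q v) := by
  obtain ⟨x, y, z, F, hxy, hyz, hzx, hF, hpos⟩ := hG.exists_stacked hp.1
  have hpos' : Positive p F := fun g hg => by
    have := hpos g hg
    simp only [orient_sim] at this
    exact (pos_iff_pos_of_mul_pos this).1 (sq_add_sq_pos hd)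
  obtain ⟨q, hq, hpt, hcr⟩ := hF.exists_realization hpos' hf
  refine ⟨q, fun v => hpt v trivial, fun u v => hcr u trivial v trivial, fun a' d' hd' => ?_⟩
  have hq' : Positive (fun v => sim a' d' (q v)) F := fun g hg => by
    simp only [orient_sim]
    exact mul_pos (sq_add_sq_pos hd') (hq g hg)
  have hS := hF.sameEmbedding hxy hyz hzx hpos hq'
  exact ⟨(hF.invariant hq').isPlanarDrawing,
    fun v a b c ha hb hc => (hp.2.rotation v a b c ha hb hc).trans (hS.rotation v a b c ha hb hc),
    fun u v => (hp.2.outer u v).trans (hS.outer u v)⟩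

lemma exists_line_of_collinear {R : Set Plane} (h : Collinear ℝ R) :
    ∃ a d : Plane, d ≠ 0 ∧ ∀ x ∈ R, side a d x = 0 := by
  obtain ⟨a, d, hR⟩ := (collinear_iff_exists_forall_eq_smul_vadd R).1 h
  by_cases hd : d = 0
  -- A zero direction means that `R` has at most one point, and any line through `a` contains it.
  · refine ⟨a, !₂[1, 0], fun h0 => ?_, fun x hx => ?_⟩
    · have := congrArg (fun z : Plane => z 0) h0
      simp at this
    · obtain ⟨r, rfl⟩ := hR x hx
      simp [hd, side, cross]
  · refine ⟨a, d, hd, fun x hx => ?_⟩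
    obtain ⟨r, rfl⟩ := hR x hx
    rw [vadd_eq_add, add_comm]
    exact side_line a d r

theorem PlaneGraph.IsPlane3Tree.isFreeCollinearSet [Fintype V] {G : PlaneGraph V}
    (hG : G.IsPlane3Tree) {R : Set V} (hR : G.IsCollinearSet R) : G.IsFreeCollinearSet R := by
  obtain ⟨p, hp, hcol⟩ := hR
  obtain ⟨a, d, hd, hline⟩ := exists_line_of_collinear hcol
  set P : V → Plane := fun v => coord a d (p v) with hP
  have hpP : (fun v => sim a d (P v)) = p := funext fun v => sim_coord hd (p v)
  have hax : ∀ r : R, P r 1 = 0 := fun r => by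
    have := hline (p r) ⟨r, r.2, rfl⟩
    simp [hP, coord, this]
  have hinj : Function.Injective fun r : R => P r 0 := by
    intro r r' h
    have h1 : P r = P r' := plane_ext h (by rw [hax, hax])
    have h2 : p r = p r' := by
      rw [← sim_coord hd (p r), ← sim_coord hd (p r')]
      exact congrArg (sim a d) h1
    exact Subtype.ext (hp.1.injective h2)
  -- The order on `R` is the order of abscissas in the given collinear drawing.
  refine ⟨LinearOrder.lift' _ hinj, fun a' d' hd' t ht => ?_⟩
  obtain ⟨f, hf, hft⟩ := exists_strictMono_extension (A := Set.univ) (r := fun r : R => P r 0)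
    (t := t) (fun x _ y _ hxy => ht hxy) (fun x _ y _ hxy => by rw [hinj hxy])
  obtain ⟨q, hq, -, hdraw⟩ := hG.exists_coordinates hd (hpP.symm ▸ hp) hf
  refine ⟨_, hdraw a' d' hd', fun r => ?_⟩
  rw [sim_of_axis ((sign_eq_iff_zero (hq r).sign).2 (hax r)), (hq r).axis (hax r),
    hft r trivial]

theorem PlaneGraph.IsPlane3Tree.exists_drawing [Fintype V] {G : PlaneGraph V}
    (hG : G.IsPlane3Tree) {p : V → Plane} (hp : G.IsDrawing p) {a d : Plane} (hd : d ≠ 0)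
    {A : Set (V ⊕ Sym2 V)} (hA : A ⊆ lineElements G.graph p a d) {t : V ⊕ Sym2 V → ℝ}
    (ht : ∀ x ∈ A, ∀ y ∈ A, Precedes p a d x y → t x < t y) :
    ∃ q : V → Plane, G.IsDrawing q ∧
      (∀ v, SignType.sign (side a d (q v)) = SignType.sign (side a d (p v))) ∧
      ∀ x ∈ A, a + t x • d ∈ cell q x := by
  classical
  set P : V → Plane := fun v => coord a d (p v) with hP
  have hpP : p = fun v => sim a d (P v) := funext fun v => (sim_coord hd (p v)).symm
  rw [hpP] at hp hA ht ⊢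
  -- The membership in `A` is moved under the quantifier so that positions form a total function;
  -- the value outside `A` plays no role.
  have hex : ∀ x, ∃ s : ℝ, x ∈ A → a + s • d ∈ cell (fun v => sim a d (P v)) x ∧
      ∀ (f : ℝ → ℝ) (q : V → Plane), (∀ v, PointRel f (P v) (q v)) →
        (∀ u v, G.graph.Adj u v → CrossRel f (P u) (q u) (P v) (q v)) →
        a + f s • d ∈ cell (fun v => sim a d (q v)) x := by
    intro x
    by_cases hx : x ∈ A
    · obtain ⟨s, hs⟩ := exists_mem_cell hd (hA hx)
      exact ⟨s, fun _ => hs⟩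
    · exact ⟨0, fun h => absurd h hx⟩
  choose r hr using hex
  obtain ⟨f, hf, hft⟩ := exists_strictMono_extension (A := A) (r := r) (t := t)
    (fun x hx y hy hxy => ht x hx y hy ⟨r x, r y, hxy, (hr x hx).1, (hr y hy).1⟩)
    (fun x hx y hy hxy => by
      rw [hp.1.eq_of_mem_cell (hA hx) (hA hy) (side_line a d (r x)) (hr x hx).1
        (hxy ▸ (hr y hy).1)])
  obtain ⟨q, hq, hcr, hdraw⟩ := hG.exists_coordinates hd hp hf
  refine ⟨_, hdraw a d hd, fun v => ?_, fun x hx => ?_⟩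
  · rw [side_sim, side_sim, sign_mul, sign_mul, (hq v).sign]
  · rw [← hft x hx]
    exact (hr x hx).2 f q hq hcr

end Main

theorem theorem3 {V : Type*} [Fintype V] (G : PlaneGraph V) (hG : G.IsPlane3Tree) :
    (∀ R : Set V, G.IsCollinearSet R → G.IsFreeCollinearSet R) ∧
    (∀ Ψ : V → Plane, G.IsDrawing Ψ → ∀ a d : Plane, d ≠ 0 →
      ∀ A : Set (V ⊕ Sym2 V), A ⊆ lineElements G.graph Ψ a d →
      ∀ t : V ⊕ Sym2 V → ℝ,
        (∀ x ∈ A, ∀ y ∈ A, Precedes Ψ a d x y → t x < t y) →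
        ∃ Γ : V → Plane, G.IsDrawing Γ ∧
          (∀ v : V, SignType.sign (side a d (Γ v)) = SignType.sign (side a d (Ψ v))) ∧
          ∀ x ∈ A, a + t x • d ∈ cell Γ x) :=
  ⟨fun _ hR => hG.isFreeCollinearSet hR, fun _ hΨ _ _ hd _ hA _ ht =>
    hG.exists_drawing hΨ hd hA ht⟩
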